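/- Let $k$ be a field of characteristic different from $2$ and $3$, let $n\ge 0$, $r\ge 1$, $d_1,\dots,d_r\ge 2$ be integers, and put $m+1=d_1+\dots+d_r$. Let $\mathcal{A}=(\mathcal{A}^{(1)},\dots,\mathcal{A}^{(r)})\in k^{n+1}\otimes\bigl(\bigoplus_{l=1}^r \mathrm{Sym}_2 k^{d_l}\bigr)$ be a block-diagonal tensor: each $\mathcal{A}^{(l)}$ is an $(n+1)$-tuple $(A^{(l)}_0,\dots,A^{(l)}_n)$ of symmetric $d_l\times d_l$ matrices over $k$, and, writing $\mathcal{A}^{(l)}(\mathbf{x},\cdot,\cdot)=\sum_j x_jA^{(l)}_j$, each form $f_l=\det \mathcal{A}^{(l)}(\mathbf{x},\cdot,\cdot)\in k[x_0,\dots,x_n]$ is irreducible. Let $A_j$ be the block-diagonal $(m+1)\times(m+1)$ matrix with blocks $A^{(1)}_j,\dots,A^{(r)}_j$, so that $\mathcal{A}$ is also the trilinear form $\mathcal{A}(x,y,y')=\sum_j x_j\, y^TA_jy'$. Let $X=Z(f_1,\dots,f_r)\subseteq\mathbb{P}^n$ be the associated intersection of symmetroids and let $\mathfrak{C}=\{y\in\mathbb{P}^m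 : \mathcal{A}(\cdot,y,y)=0\}=Z(\mathbf{y}^TA_0\mathbf{y},\dots,\mathbf{y}^TA_n\mathbf{y})\subseteq\mathbb{P}^m$ be the Cayley variety (both as schemes). Let $X^{\mathrm{n.e.}}\subseteq X$ be the open subscheme of points $x$ at which every block $\mathcal{A}^{(l)}(x,\cdot,\cdot)$ has corank at most $1$ (the complement of the essential singularities). An accidental singularity of $X$ is a singular point of $X$ that lies in $X^{\mathrm{n.e.}}$; a coincident singularity of $X$ is an accidental singularity $x$ for which there are two distinct strict subsets $S,T\subsetneq\{1,\dots,r\}$ such that $x$ is a singular point both of $\bigcap_{l\in S}X_l$ and of $\bigcap_{l\in T}X_l$, where $X_l=Z(f_l)$. Here a point of a closed subscheme of $\mathbb{P}^n$ is singular if the rank of the Jacobian matrix of the defining equations at the point is smaller than the codimension of the subscheme there. Assume that $X$ is a complete intersection (that is, $f_1,\dots,f_r$ is a regular sequence), and let $\mathrm{sing}\, X^{\mathrm{n.e.}}$ be the closed subscheme of $X^{\mathrm{n.e.}}$ defined by the $r\times r$ minors of the Jacobian matrix $(\partial f_l/\partial x_j)_{l,j}$. Assume further that $\mathrm{sing}\,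 X^{\mathrm{n.e.}}$ has dimension $0$ and that $X$ has no coincident singularities. Then the first projection from the closed subscheme $$\{(x,y)\in X^{\mathrm{n.e.}}\times_k\mathbb{P}^m : \mathcal{A}(x,y,\cdot)=0,\ y\in\mathfrak{C}\}$$ of $X^{\mathrm{n.e.}}\times_k\mathbb{P}^m$ to $X^{\mathrm{n.e.}}$ factors through $\mathrm{sing}\, X^{\mathrm{n.e.}}$, and the resulting morphism to $\mathrm{sing}\, X^{\mathrm{n.e.}}$ is a finite cover of degree $2^{r-1}$, i.e. it is finite and flat, of constant rank $2^{r-1}$. -/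

import Mathlib

open CategoryTheory CategoryTheory.Limits AlgebraicGeometry MvPolynomial

universe u

attribute [instance] MvPolynomial.gradedAlgebra

namespace Symmetroid

noncomputable section

/-! ### Projective space and subschemes cut out by equations -/

/-- The grading of `k[x_i : i ∈ ι]` by degree. -/
abbrev grading (k : Type u) [Field k] (ι : Type) : ℕ → Submodule k (MvPolynomial ι k) :=
  homogeneousSubmodule ι k

/-- The projective space `Proj k[x_i : i ∈ ι]` with homogeneous coordinates indexed by `ι`. -/
abbrev PP (k : Type u) [Field k] (ι : Type) : Scheme.{u} := Proj (grading k ι)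

/-- The structure morphism of projective space over `Spec k`. -/
def PP.toSpec (k : Type u) [Field k] (ι : Type) : PP k ι ⟶ Spec (.of k) :=
  Proj.toSpecZero (grading k ι) ≫
    Spec.map (CommRingCat.ofHom (algebraMap k (grading k ι 0)))

/-- The standard affine chart `x_i ≠ 0`. -/
abbrev chart (k : Type u) [Field k] {ι : Type} (i : ι) : (PP k ι).Opens :=
  Proj.basicOpen (grading k ι) (X i)

/-- The function `F / x_i ^ e` on the chart `x_i ≠ 0`, for a form `F` of degree `e`. -/
def dehom {k : Type u} [Field k] {ι : Type} (i : ι) {e : ℕ} (F : MvPolynomial ι k)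
    (hF : F.IsHomogeneous e) : Γ(PP k ι, chart k i) :=
  (Proj.awayToSection (grading k ι) (X i)).hom
    (HomogeneousLocalization.Away.mk (grading k ι) (d := 1)
      ((mem_homogeneousSubmodule 1 _).2 (isHomogeneous_X k i)) e F
      ((mem_homogeneousSubmodule _ _).2 (by simpa using hF)))

/-- The (quasi-coherent) ideal sheaf generated by sections `G c` over open subsets `U c`:
the smallest ideal sheaf containing all of them. -/
def idealSpan {Y : Scheme.{u}} {κ : Type*} (U : κ → Y.Opens) (G : ∀ c, Set Γ(Y, U c)) :
    Y.IdealSheafData :=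
  sInf {J | ∀ c, ∀ s ∈ G c, ∀ (V : Y.affineOpens) (h : V.1 ≤ U c),
    (Y.presheaf.map (homOfLE h).op).hom s ∈ J.ideal V}

/-- The ideal sheaf on projective space of the closed subscheme `Z(G)` defined by a set `G` of
homogeneous polynomials. -/
def projIdeal {k : Type u} [Field k] {ι : Type} (G : Set (MvPolynomial ι k)) :
    (PP k ι).IdealSheafData :=
  idealSpan (fun i : ι => chart k i)
    (fun i => {s | ∃ (e : ℕ) (F : MvPolynomial ι k) (hF : F.IsHomogeneous e),
      F ∈ G ∧ s = dehom i F hF})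

/-! ### Values at points, rank, singular points -/

/-- The homogeneous prime ideal of a point of projective space. -/
def pointIdeal {k : Type u} [Field k] {ι : Type} (p : PP k ι) : Ideal (MvPolynomial ι k) :=
  p.asHomogeneousIdeal.toIdeal

instance {k : Type u} [Field k] {ι : Type} (p : PP k ι) : (pointIdeal p).IsPrime :=
  ProjectiveSpectrum.isPrime p

/-- A field over which the point `p` of projective space has homogeneous coordinates: the residue
field of the generic point of the line over `p` in the affine cone. Ranks of matrices at `p` are
computed over it. -/
abbrev coordField {k : Type u} [Field k] {ι : Type} (p : PP k ι) : Type u :=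
  (pointIdeal p).ResidueField

/-- The rank at `p` of a matrix of homogeneous polynomials. -/
def rankAt {k : Type u} [Field k] {ι : Type} {a b : Type} [Fintype b]
    (M : Matrix a b (MvPolynomial ι k)) (p : PP k ι) : ℕ :=
  (M.map (algebraMap (MvPolynomial ι k) (coordField p))).rank

/-- The Jacobian matrix of a family of polynomials. -/
def jacobian {k : Type u} [Field k] {n : ℕ} {σ : Type} (F : σ → MvPolynomial (Fin (n + 1)) k) :
    Matrix σ (Fin (n + 1)) (MvPolynomial (Fin (n + 1)) k) :=
  Matrix.of fun l j => pderiv j (F l)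

/-- The codimension at `p` of the subscheme `Z(F)` of projective space. -/
def codimAt {k : Type u} [Field k] {n : ℕ} {σ : Type} (F : σ → MvPolynomial (Fin (n + 1)) k)
    (p : PP k (Fin (n + 1))) : ℕ∞ :=
  ((Ideal.span (Set.range F)).map (algebraMap (MvPolynomial (Fin (n + 1)) k)
    (Localization.AtPrime (pointIdeal p)))).height

/-- `p` is a singular point of the subscheme `Z(F)` of `ℙⁿ` defined by homogeneous polynomials:
`p` lies on `Z(F)`, and the rank of the Jacobian matrix at `p` is smaller than the codimension of
`Z(F)` at `p`. -/
def IsSingularPoint {k : Type u} [Field k] {n : ℕ} {σ : Type}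
    (F : σ → MvPolynomial (Fin (n + 1)) k) (p : PP k (Fin (n + 1))) : Prop :=
  (∀ l, F l ∈ pointIdeal p) ∧ (rankAt (jacobian F) p : ℕ∞) < codimAt F p

/-! ### Lower semicontinuity of the rank -/

theorem exists_rows {K : Type*} [Field K] {a b : Type*} [Fintype a] [Fintype b]
    (M : Matrix a b K) {s : ℕ} (h : s ≤ M.rank) :
    ∃ e : Fin s → a, (M.submatrix e id).rank = s := by
  classical
  rw [Matrix.rank_eq_finrank_span_row] at h
  obtain ⟨κ, f, -, hspan, hli⟩ := exists_linearIndependent' K M.row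
  have : Finite κ := hli.finite
  have := Fintype.ofFinite κ
  rw [← hspan, finrank_span_eq_card hli] at h
  obtain ⟨g⟩ : Nonempty (Fin s ↪ κ) :=
    Function.Embedding.nonempty_of_card_le (by simpa using h)
  refine ⟨fun i => f (g i), ?_⟩
  have h2 : LinearIndependent K (M.submatrix (fun i => f (g i)) id).row :=
    hli.comp g g.injective
  simpa using h2.rank_matrix

theorem exists_minor {K : Type*} [Field K] {a b : Type*} [Fintype a] [Fintype b]
    (M : Matrix a b K) {s : ℕ} (h : s ≤ M.rank) :
    ∃ (e : Fin s → a) (e' : Fin s → b), (M.submatrix e e').det ≠ 0 := by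
  obtain ⟨e, he⟩ := exists_rows M h
  obtain ⟨e', he'⟩ := exists_rows (M.submatrix e id).transpose (s := s)
    (by rw [Matrix.rank_transpose, he])
  refine ⟨e, e', ?_⟩
  have h3 : (M.submatrix e e').rank = s := by
    rw [← Matrix.rank_transpose]; exact he'
  have h4 : LinearIndependent K (M.submatrix e e').row := by
    rw [linearIndependent_iff_card_eq_finrank_span, Set.finrank,
      ← Matrix.rank_eq_finrank_span_row, h3, Fintype.card_fin]
  have := Matrix.linearIndependent_rows_iff_isUnit.1 h4
  exact ((Matrix.isUnit_iff_isUnit_det _).1 this).ne_zero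

theorem le_rank_of_minor {K : Type*} [Field K] {a b : Type*} [Fintype a] [Fintype b]
    (M : Matrix a b K) {s : ℕ} (e : Fin s → a) (e' : Fin s → b)
    (h : (M.submatrix e e').det ≠ 0) : s ≤ M.rank := by
  have h1 : (M.submatrix e e').rank = s := by
    rw [Matrix.rank_of_isUnit _ ((Matrix.isUnit_iff_isUnit_det _).2 (isUnit_iff_ne_zero.2 h)),
      Fintype.card_fin]
  have h2 : (M.submatrix e id).rank ≤ M.rank := by
    rw [Matrix.rank_eq_finrank_span_row, Matrix.rank_eq_finrank_span_row]
    refine Submodule.finrank_mono (Submodule.span_mono ?_)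
    rintro _ ⟨i, rfl⟩
    exact ⟨e i, rfl⟩
  have h3 : (M.submatrix e e').rank ≤ (M.submatrix e id).rank := by
    rw [← Matrix.rank_transpose, ← Matrix.rank_transpose (M.submatrix e id),
      Matrix.rank_eq_finrank_span_row, Matrix.rank_eq_finrank_span_row]
    refine Submodule.finrank_mono (Submodule.span_mono ?_)
    rintro _ ⟨i, rfl⟩
    exact ⟨e' i, rfl⟩
  omega

theorem isOpen_le_rankAt {k : Type u} [Field k] {ι : Type} {a b : Type} [Fintype a] [Fintype b]
    (M : Matrix a b (MvPolynomial ι k)) (s : ℕ) : IsOpen {p : PP k ι | s ≤ rankAt M p} := by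
  have key : {p : PP k ι | s ≤ rankAt M p} =
      ⋃ (e : Fin s → a) (e' : Fin s → b),
        ((Proj.basicOpen (grading k ι) (M.submatrix e e').det : (PP k ι).Opens) :
          Set (PP k ι)) := by
    ext p
    have hdet : ∀ (e : Fin s → a) (e' : Fin s → b),
        ((M.map (algebraMap _ (coordField p))).submatrix e e').det ≠ 0 ↔
          p ∈ Proj.basicOpen (grading k ι) (M.submatrix e e').det := by
      intro e e'
      have h : ((M.map (algebraMap _ (coordField p))).submatrix e e').det =
          algebraMap _ (coordField p) (M.submatrix e e').det :=
        (RingHom.map_det (algebraMap _ (coordField p)) (M.submatrix e e')).symm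
      rw [h, Ne, Ideal.algebraMap_residueField_eq_zero]
      rfl
    simp only [Set.mem_ofPred_eq, Set.mem_iUnion, SetLike.mem_coe, ← hdet]
    exact ⟨fun h => exists_minor _ h, fun ⟨e, e', h⟩ => le_rank_of_minor _ e e' h⟩
  rw [key]
  exact isOpen_iUnion fun e => isOpen_iUnion fun e' => (Proj.basicOpen _ _).2

/-! ### Block-diagonal tensors -/

/-- A tensor in `k^{n+1} ⊗ (⨁_l Sym₂ k^{d_l})`: each block is an `(n+1)`-tuple of symmetric
matrices, its slices. -/
structure BlockTensor (k : Type u) [Field k] (n r : ℕ) (d : Fin r → ℕ) where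
  slice : ∀ l, Fin (n + 1) → Matrix (Fin (d l)) (Fin (d l)) k
  symm : ∀ l j, (slice l j).IsSymm

namespace BlockTensor

variable {k : Type u} [Field k] {n r : ℕ} {d : Fin r → ℕ} (A : BlockTensor k n r d)

/-- The index set of the `m + 1 = ∑ d_l` homogeneous coordinates of `ℙᵐ`, block by block. -/
abbrev Idx {r : ℕ} (d : Fin r → ℕ) : Type := Σ l : Fin r, Fin (d l)

/-- The matrix of linear forms `A⁽ˡ⁾(x, ·, ·)`. -/
def blockMatrix (l : Fin r) : Matrix (Fin (d l)) (Fin (d l)) (MvPolynomial (Fin (n + 1)) k) :=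
  Matrix.of fun s t => ∑ j, C (A.slice l j s t) * X j

/-- The slice `A_j` of the tensor regarded as an element of `k^{n+1} ⊗ Sym₂ k^{m+1}`. -/
def fullSlice (j : Fin (n + 1)) : Matrix (Idx d) (Idx d) k :=
  Matrix.blockDiagonal' fun l => A.slice l j

/-- The entry `A(x, e_s, e_t)` of the matrix of linear forms `A(x, ·, ·)`. -/
def entry (s t : Idx d) : MvPolynomial (Fin (n + 1)) k :=
  ∑ j, C (A.fullSlice j s t) * X j

theorem isHomogeneous_entry (s t : Idx d) : (A.entry s t).IsHomogeneous 1 :=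
  IsHomogeneous.sum _ _ _ fun j _ => by
    simpa using (isHomogeneous_C (Fin (n + 1)) (A.fullSlice j s t)).mul (isHomogeneous_X k j)

/-- The equation `f_l = det A⁽ˡ⁾(x, ·, ·)` of the symmetroid `X_l`. -/
def detForm (l : Fin r) : MvPolynomial (Fin (n + 1)) k := (A.blockMatrix l).det

/-- The quadratic form `A(e_j, y, y)`. -/
def quadric (j : Fin (n + 1)) : MvPolynomial (Idx d) k :=
  ∑ s, ∑ t, C (A.fullSlice j s t) * X s * X t

/-- The intersection of symmetroids `X = X_1 ∩ … ∩ X_r` is a complete intersection in `ℙⁿ`. -/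
def IsCompleteIntersection : Prop :=
  RingTheory.Sequence.IsRegular (MvPolynomial (Fin (n + 1)) k) (List.ofFn A.detForm)

/-- The open subset of `ℙⁿ` where every block has corank at most one. -/
def corankLEOne : (PP k (Fin (n + 1))).Opens where
  carrier := {p | ∀ l, d l ≤ rankAt (A.blockMatrix l) p + 1}
  is_open' := by
    have h : {p : PP k (Fin (n + 1)) | ∀ l, d l ≤ rankAt (A.blockMatrix l) p + 1} =
        ⋂ l, {p | d l - 1 ≤ rankAt (A.blockMatrix l) p} := by
      ext p
      simp only [Set.mem_ofPred_eq, Set.mem_iInter, tsub_le_iff_right]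
    rw [h]
    exact isOpen_iInter_of_finite fun l => isOpen_le_rankAt _ _

/-- `X^{n.e.}`: the complement in `X` of the essential singularities, that is, of the points where
some block has corank at least two. -/
def Xne : Scheme.{u} :=
  ((projIdeal (Set.range A.detForm)).comap A.corankLEOne.ι).subscheme

/-- The inclusion of `X^{n.e.}` in `ℙⁿ`. -/
def XneToPP : A.Xne ⟶ PP k (Fin (n + 1)) :=
  ((projIdeal (Set.range A.detForm)).comap A.corankLEOne.ι).subschemeι ≫ A.corankLEOne.ι

/-- The ideal sheaf on `X^{n.e.}` generated by the `r × r` minors of the Jacobian matrix of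
`f_1, …, f_r`. -/
def singIdeal : A.Xne.IdealSheafData :=
  (projIdeal (Set.range fun e : Fin r → Fin (n + 1) =>
    ((jacobian A.detForm).submatrix id e).det)).comap A.XneToPP

/-- The singular subscheme `sing X^{n.e.}` when `X` is a complete intersection (of codimension
`r`). -/
def singXne : Scheme.{u} := A.singIdeal.subscheme

/-- An accidental singularity of `X`: a singular point which is not an essential singularity. -/
def IsAccidental (p : PP k (Fin (n + 1))) : Prop :=
  IsSingularPoint A.detForm p ∧ p ∈ A.corankLEOne

/-- A coincident singularity of `X`: an accidental singularity which is a singular point of the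
intersections of symmetroids defined by two distinct strict subsets of the blocks. -/
def IsCoincident (p : PP k (Fin (n + 1))) : Prop :=
  A.IsAccidental p ∧ ∃ S T : Finset (Fin r), S ≠ Finset.univ ∧ T ≠ Finset.univ ∧ S ≠ T ∧
    IsSingularPoint (fun l : S => A.detForm l) p ∧ IsSingularPoint (fun l : T => A.detForm l) p

/-- The ideal sheaf on `ℙᵐ` of the Cayley variety `A(·, y, y) = 0`. -/
def cayleyIdeal : (PP k (Idx d)).IdealSheafData := projIdeal (Set.range A.quadric)

/-- For a scheme `Y` with morphisms `x` to `ℙⁿ` and `y` to `ℙᵐ`, the ideal sheaf of the closed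
subscheme of `Y` defined by `A(x, y, ·) = 0`. Over the open set where `x_i ≠ 0` and `y_j ≠ 0`
the equations are `∑ s, (A(x, e_s, e_t) / x_i) * (y_s / y_j) = 0`, for all `t`. -/
def bilinearIdeal {Y : Scheme.{u}} (x : Y ⟶ PP k (Fin (n + 1))) (y : Y ⟶ PP k (Idx d)) :
    Y.IdealSheafData :=
  idealSpan (fun c : Fin (n + 1) × Idx d => x ⁻¹ᵁ chart k c.1 ⊓ y ⁻¹ᵁ chart k c.2)
    (fun c => Set.range fun t : Idx d => ∑ s : Idx d,
      (Y.presheaf.map (homOfLE inf_le_left).op).hom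
          ((x.app (chart k c.1)).hom (dehom c.1 (A.entry s t) (A.isHomogeneous_entry s t))) *
        (Y.presheaf.map (homOfLE inf_le_right).op).hom
          ((y.app (chart k c.2)).hom (dehom c.2 (X s) (isHomogeneous_X k s))))

/-- The product `X^{n.e.} × ℙᵐ` over `k`. -/
abbrev product : Scheme.{u} :=
  pullback (A.XneToPP ≫ PP.toSpec k (Fin (n + 1))) (PP.toSpec k (Idx d))

/-- The ideal sheaf on `X^{n.e.} × ℙᵐ` of the incidence scheme. -/
def incidenceIdeal : A.product.IdealSheafData :=
  A.bilinearIdeal (pullback.fst _ _ ≫ A.XneToPP) (pullback.snd _ _) ⊔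
    A.cayleyIdeal.comap (pullback.snd _ _)

/-- The incidence scheme `{(x, y) ∈ X^{n.e.} × ℙᵐ : A(x, y, ·) = 0, y ∈ 𝔠}`. -/
def incidence : Scheme.{u} := A.incidenceIdeal.subscheme

/-- The first projection from the incidence scheme to `X^{n.e.}`. -/
def incidenceFst : A.incidence ⟶ A.Xne := A.incidenceIdeal.subschemeι ≫ pullback.fst _ _

end BlockTensor

end

end Symmetroid

/-! Near a point of `X` where every block has corank at most one, each block has a principal minor
of size `d_l - 1`, with some index `i_l`, that is invertible. The kernel of the block is then free
of rank one, spanned by column `i_l` of its adjugate, and the adjugate itself is a rank-one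
symmetric matrix. So a solution of `A(x, y, ·) = 0` is determined by one pivot coordinate `c_l =
y_{l, i_l}` per block. By Jacobi's formula for the derivative of a determinant, the value of the
`j`-th quadric at such a `y` is `∑ a_l c_l² ∂f_l/∂x_j`, where `a_l` is the inverse of the principal
minor. Hence `y` lies on the Cayley variety exactly when the vector `(a_l c_l²)` is in the left
kernel of the Jacobian matrix.

Some coordinate of `y`, and with it some pivot, is locally a unit, so this kernel vector forces the
maximal minors of the Jacobian matrix to vanish: the projection factors through the singular
subscheme.

Conversely, the Jacobian matrix has corank at most one at every point there. At corank two or more,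
dropping any one equation would leave a singular point, because any subfamily of a regular sequence
still cuts out at least the expected codimension; two different omissions would make the point
coincident (`le_rankAt_jacobian_add_one`). So some minor obtained by omitting a row `o` and choosing
columns is a unit, and the left kernel is spanned by the vector of signed minors `μ_l` on these
columns. The condition becomes `μ_o a_l c_l² = μ_l a_o c_o²`. It makes `c_o` a unit, so `y` can be
normalized by `c_o = 1`, and then each of the `r - 1` other pivots is an arbitrary square root of a
prescribed function. Adjoining a square root is free of rank two, whatever the function, which gives
a finite flat cover of rank `2 ^ (r - 1)`.

To obtain an isomorphism of schemes rather than a count of points, the argument is carried out on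
`T`-valued points over an arbitrary base (`incidence_coordinates`, `exists_incidence_point`,
`exists_isPullback`). This rests on two dictionaries: a morphism factors through a subscheme cut out
by equations iff it pulls the equations back to zero (`IsCompatible.idealSpan_le_ker_iff`), and
morphisms into a chart of projective space are tuples of functions (`exists_hom_of_coordinates`,
`hom_ext_of_evalAt`). -/

namespace Symmetroid

noncomputable section

section

/-! ### Ideal sheaves generated by compatible families of sections -/

section IdealSpan

variable {Y : Scheme.{u}} {κ : Type*} (U : κ → Y.Opens) (G : ∀ c, Set Γ(Y, U c))

/-- The ideal of the stalk at `x` generated by the germs of the sections `G c`. -/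
def stalkIdeal (x : Y) : Ideal (Y.presheaf.stalk x) :=
  ⨆ (c : κ) (hx : x ∈ U c), Ideal.span ((Y.presheaf.germ (U c) x hx).hom '' G c)

/-- The families `G c` generate the same ideals on the overlaps of their domains. -/
def IsCompatible : Prop :=
  ∀ (c c' : κ) (x : Y) (hx : x ∈ U c) (hx' : x ∈ U c'), ∀ s ∈ G c,
    (Y.presheaf.germ (U c) x hx).hom s ∈
      Ideal.span ((Y.presheaf.germ (U c') x hx').hom '' G c')

/-- The sections over `V` whose germs lie in the ideals generated by the `G c`. -/
def sectionsIdeal (V : Y.Opens) : Ideal Γ(Y, V) :=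
  ⨅ (x : Y) (hx : x ∈ V), (stalkIdeal U G x).comap (Y.presheaf.germ V x hx).hom

variable {U G}

theorem mem_sectionsIdeal {V : Y.Opens} {a : Γ(Y, V)} :
    a ∈ sectionsIdeal U G V ↔
      ∀ (x : Y) (hx : x ∈ V), (Y.presheaf.germ V x hx).hom a ∈ stalkIdeal U G x := by
  simp [sectionsIdeal]

theorem IsCompatible.stalkIdeal_eq (H : IsCompatible U G) (c : κ) (x : Y) (hx : x ∈ U c) :
    stalkIdeal U G x = Ideal.span ((Y.presheaf.germ (U c) x hx).hom '' G c) := by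
  refine le_antisymm (iSup₂_le fun c' hx' => Ideal.span_le.2 ?_)
    (le_iSup₂_of_le c hx le_rfl)
  rintro _ ⟨s, hs, rfl⟩
  exact H c' c x hx' hx s hs

theorem res_res {V W Z : Y.Opens} (h : V ≤ W) (h' : W ≤ Z) (s : Γ(Y, Z)) :
    (Y.presheaf.map (homOfLE h).op).hom ((Y.presheaf.map (homOfLE h').op).hom s) =
      (Y.presheaf.map (homOfLE (h.trans h')).op).hom s := by
  rw [← CommRingCat.comp_apply, ← Functor.map_comp]
  rfl

theorem germ_res_hom {V W : Y.Opens} (h : V ≤ W) (x : Y) (hx : x ∈ V) (s : Γ(Y, W)) :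
    (Y.presheaf.germ V x hx).hom ((Y.presheaf.map (homOfLE h).op).hom s) =
      (Y.presheaf.germ W x (h hx)).hom s :=
  Y.presheaf.germ_res_apply (homOfLE h) x hx s

theorem mem_sectionsIdeal_res {V W : Y.Opens} (h : V ≤ W) {a : Γ(Y, W)}
    (ha : a ∈ sectionsIdeal U G W) :
    (Y.presheaf.map (homOfLE h).op).hom a ∈ sectionsIdeal U G V := by
  rw [mem_sectionsIdeal] at ha ⊢
  intro x hx
  rw [germ_res_hom]
  exact ha x (h hx)

/-- An ideal on an affine open set is determined by its stalks, and by compatibility the generators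
of a single `U c` already generate all the stalk ideals there. -/
theorem IsCompatible.sectionsIdeal_eq (H : IsCompatible U G) {V : Y.Opens} (hV : IsAffineOpen V)
    {c : κ} (h : V ≤ U c) :
    sectionsIdeal U G V = Ideal.span ((Y.presheaf.map (homOfLE h).op).hom '' G c) := by
  have key : ∀ (x : Y) (hx : x ∈ V),
      (Ideal.span ((Y.presheaf.map (homOfLE h).op).hom '' G c)).map
        (Y.presheaf.germ V x hx).hom = stalkIdeal U G x := by
    intro x hx
    rw [H.stalkIdeal_eq c x (h hx), Ideal.map_span, Set.image_image]
    simp only [germ_res_hom]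
  refine le_antisymm (hV.ideal_le_iff.2 fun x hx => ?_) (Ideal.span_le.2 ?_)
  · rw [key x hx, Ideal.map_le_iff_le_comap]
    exact fun a ha => mem_sectionsIdeal.1 ha x hx
  · rintro a ha
    rw [SetLike.mem_coe, mem_sectionsIdeal]
    intro x hx
    rw [← key x hx]
    exact Ideal.mem_map_of_mem _ (Ideal.subset_span ha)

/-- If a section over a basic open subset lies in the ideal, it is, up to a power of the
denominator, the restriction of a section in the ideal. -/
theorem IsCompatible.exists_pow_mul (H : IsCompatible U G) (hU : ⨆ c, U c = ⊤)
    {V : Y.Opens} (hV : IsAffineOpen V) (f : Γ(Y, V)) (a : Γ(Y, Y.basicOpen f))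
    (ha : a ∈ sectionsIdeal U G (Y.basicOpen f)) :
    ∃ (N : ℕ) (b : Γ(Y, V)), b ∈ sectionsIdeal U G V ∧
      (Y.presheaf.map (homOfLE (Y.basicOpen_le f)).op).hom b =
        (Y.presheaf.map (homOfLE (Y.basicOpen_le f)).op).hom f ^ N * a := by
  classical
  have := hV.isLocalization_basicOpen f
  obtain ⟨⟨b, ⟨_, N, rfl⟩⟩, hb⟩ := IsLocalization.surj (Submonoid.powers f) a
  replace hb : (Y.presheaf.map (homOfLE (Y.basicOpen_le f)).op).hom b =
      (Y.presheaf.map (homOfLE (Y.basicOpen_le f)).op).hom f ^ N * a := by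
    rw [mul_comm, ← map_pow]; exact hb.symm
  -- Near `x` some basic open set `D(g)` lies in a single `U c`. There the ideal over `D(fg)` is the
  -- extension of the ideal over `D(g)`, so clearing denominators costs only a power of `f`.
  have hloc : ∀ x : V, ∃ (g : Γ(Y, V)) (M : ℕ), x.1 ∈ Y.basicOpen g ∧
      (Y.presheaf.map (homOfLE (Y.basicOpen_le g)).op).hom (f ^ M * b) ∈
        sectionsIdeal U G (Y.basicOpen g) := by
    rintro ⟨x, hx⟩
    obtain ⟨c, hc⟩ := TopologicalSpace.Opens.mem_iSup.1 (hU.ge (Set.mem_univ x))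
    obtain ⟨g, hg, hxg⟩ := hV.exists_basicOpen_le (V := U c) ⟨x, hc⟩ hx
    refine ⟨g, ?_⟩
    set ρ := (Y.presheaf.map (homOfLE (Y.basicOpen_le g)).op).hom with hρ
    have hW := hV.basicOpen g
    have hle : Y.basicOpen (ρ f) ≤ Y.basicOpen f := by
      rw [hρ]
      erw [Y.basicOpen_res]
      exact inf_le_right
    have := hW.isLocalization_basicOpen (ρ f)
    have hmem : (Y.presheaf.map (homOfLE (Y.basicOpen_le (ρ f))).op).hom (ρ b) ∈
        sectionsIdeal U G (Y.basicOpen (ρ f)) := by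
      have : (Y.presheaf.map (homOfLE (Y.basicOpen_le (ρ f))).op).hom (ρ b) =
          (Y.presheaf.map (homOfLE hle).op).hom
            ((Y.presheaf.map (homOfLE (Y.basicOpen_le f)).op).hom b) :=
        (res_res _ _ b).trans (res_res _ _ b).symm
      rw [this, hb]
      exact mem_sectionsIdeal_res hle (Ideal.mul_mem_left _ _ ha)
    rw [H.sectionsIdeal_eq (hW.basicOpen (ρ f)) ((Y.basicOpen_le _).trans hg)] at hmem
    have himg : (Y.presheaf.map (homOfLE ((Y.basicOpen_le (ρ f)).trans hg)).op).hom '' G c =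
        (algebraMap Γ(Y, Y.basicOpen g) Γ(Y, Y.basicOpen (ρ f))) ''
          ((Y.presheaf.map (homOfLE hg).op).hom '' G c) := by
      rw [Set.image_image]
      refine Set.image_congr fun s _ => ?_
      exact (res_res (Y.basicOpen_le (ρ f)) hg s).symm
    rw [himg, ← Ideal.map_span, ← H.sectionsIdeal_eq hW hg] at hmem
    obtain ⟨⟨e, ⟨_, M, rfl⟩⟩, he⟩ :=
      (IsLocalization.mem_map_algebraMap_iff (Submonoid.powers (ρ f)) _).1 hmem
    obtain ⟨⟨_, M', rfl⟩, hM'⟩ :=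
      (IsLocalization.eq_iff_exists (Submonoid.powers (ρ f)) Γ(Y, Y.basicOpen (ρ f))
        (x := ρ b * ρ f ^ M) (y := e.1)).1 (by rw [map_mul]; exact he)
    refine ⟨M' + M, hxg, ?_⟩
    have : ρ (f ^ (M' + M) * b) = ρ f ^ M' * e := by
      simp only at hM'
      rw [map_mul, map_pow, pow_add, ← hM']
      ring
    rw [this]
    exact Ideal.mul_mem_left _ _ e.2
  choose g M hxg hgM using hloc
  -- By compactness the largest of finitely many exponents serves on all of `V`.
  obtain ⟨t, ht⟩ := hV.isCompact.elim_finite_subcover (fun x : V => (Y.basicOpen (g x) : Set Y))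
    (fun x => (Y.basicOpen (g x)).2) (fun x hx => Set.mem_iUnion.2 ⟨⟨x, hx⟩, hxg ⟨x, hx⟩⟩)
  refine ⟨t.sup M + N, f ^ t.sup M * b, ?_, ?_⟩
  · rw [mem_sectionsIdeal]
    intro x hx
    obtain ⟨i, hi, hxi⟩ := Set.mem_iUnion₂.1 (ht hx)
    have h1 := mem_sectionsIdeal.1 (hgM i) x hxi
    rw [germ_res_hom] at h1
    have h2 : f ^ t.sup M * b = f ^ (t.sup M - M i) * (f ^ M i * b) := by
      rw [← mul_assoc, ← pow_add, Nat.sub_add_cancel (Finset.le_sup hi)]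
    rw [h2, map_mul]
    exact Ideal.mul_mem_left _ _ h1
  · rw [map_mul, map_pow, hb]
    ring

/-- The ideal sheaf of the sections whose germs lie in the ideals generated by the `G c`. -/
def IsCompatible.idealSheaf (H : IsCompatible U G) (hU : ⨆ c, U c = ⊤) : Y.IdealSheafData where
  ideal V := sectionsIdeal U G V.1
  map_ideal_basicOpen V f := by
    refine le_antisymm (Ideal.map_le_iff_le_comap.2 fun a ha => mem_sectionsIdeal_res _ ha) ?_
    intro a ha
    obtain ⟨N, b, hb, hab⟩ := H.exists_pow_mul hU V.2 f a ha
    have hu : IsUnit ((Y.presheaf.map (homOfLE (Y.basicOpen_le f)).op).hom f ^ N) :=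
      (RingedSpace.isUnit_res_basicOpen Y.toRingedSpace f).pow N
    rw [← Ideal.unit_mul_mem_iff_mem _ hu]
    erw [← hab]
    exact Ideal.mem_map_of_mem _ hb

/-- The infimum defining `idealSpan` gives no access to its sections; this makes it explicit. Any
competitor `J` contains the generators on the basic open sets that lie in some `U c`, and these
suffice to compare stalks. -/
theorem IsCompatible.idealSpan_eq (H : IsCompatible U G) (hU : ⨆ c, U c = ⊤) :
    idealSpan U G = H.idealSheaf hU := by
  refine le_antisymm (sInf_le fun c s hs V h => ?_) (le_sInf fun J hJ V => ?_)
  · change _ ∈ sectionsIdeal U G V.1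
    rw [H.sectionsIdeal_eq V.2 h]
    exact Ideal.subset_span ⟨s, hs, rfl⟩
  · refine V.2.ideal_le_iff.2 fun x hx => ?_
    obtain ⟨c, hc⟩ := TopologicalSpace.Opens.mem_iSup.1 (hU.ge (Set.mem_univ x))
    obtain ⟨g, hg, hxg⟩ := V.2.exists_basicOpen_le (V := U c) ⟨x, hc⟩ hx
    have hWV : Y.affineBasicOpen g ≤ V := Y.affineBasicOpen_le g
    refine Ideal.map_le_iff_le_comap.2 fun a ha => ?_
    have h1 := mem_sectionsIdeal.1 ha x hx
    rw [H.stalkIdeal_eq c x hc] at h1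
    rw [Ideal.mem_comap]
    refine Ideal.span_le.2 ?_ h1
    rintro _ ⟨s, hs, rfl⟩
    have h2 := hJ c s hs (Y.affineBasicOpen g) hg
    rw [← J.map_ideal hWV] at h2
    rw [← germ_res_hom hg x hxg, SetLike.mem_coe]
    refine Ideal.map_le_iff_le_comap.2 ?_ (Ideal.mem_map_of_mem (I := Ideal.map _ _)
      (Y.presheaf.germ (Y.basicOpen g) x hxg).hom h2)
    refine Ideal.map_le_iff_le_comap.2 fun a ha => ?_
    have h4 : (Y.presheaf.germ V.1 x hx).hom a ∈ (J.ideal V).map (Y.presheaf.germ V.1 x hx).hom :=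
      Ideal.mem_map_of_mem _ ha
    rw [← germ_res_hom (Y.basicOpen_le g) x hxg a] at h4
    exact h4

/-- A morphism factors through the closed subscheme defined by a compatible family of sections
if and only if it pulls all of them back to zero. -/
theorem IsCompatible.idealSpan_le_ker_iff (H : IsCompatible U G) (hU : ⨆ c, U c = ⊤)
    {T : Scheme.{u}} (h : T ⟶ Y) :
    idealSpan U G ≤ h.ker ↔ ∀ c, ∀ s ∈ G c, (h.app (U c)).hom s = 0 := by
  rw [H.idealSpan_eq hU]
  constructor
  · intro hle c s hs
    refine TopCat.Presheaf.section_ext T.sheaf _ _ _ fun t ht => ?_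
    obtain ⟨_, ⟨V, hV, rfl⟩, hxV, hVU⟩ := Y.isBasis_affineOpens.exists_subset_of_mem_open
      (show h t ∈ (U c : Set Y) from ht) (U c).2
    replace hVU : V ≤ U c := hVU
    have h1 : (Y.presheaf.map (homOfLE hVU).op).hom s ∈ (H.idealSheaf hU).ideal ⟨V, hV⟩ := by
      change _ ∈ sectionsIdeal U G V
      rw [H.sectionsIdeal_eq hV hVU]
      exact Ideal.subset_span ⟨s, hs, rfl⟩
    have h2 := h.ideal_ker_le ⟨V, hV⟩ (hle ⟨V, hV⟩ h1)
    rw [RingHom.mem_ker] at h2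
    have h3 := congrArg (T.presheaf.germ (h ⁻¹ᵁ V) t hxV).hom h2
    rw [map_zero] at h3
    refine Eq.trans ?_ (map_zero (T.presheaf.germ (h ⁻¹ᵁ U c) t ht).hom).symm
    refine Eq.trans ?_ h3
    have e1 := h.germ_stalkMap_apply (U c) t ht s
    have e2 := h.germ_stalkMap_apply V t hxV ((Y.presheaf.map (homOfLE hVU).op).hom s)
    have e3 := germ_res_hom hVU (h t) hxV s
    exact e1.symm.trans ((congrArg (h.stalkMap t).hom e3.symm).trans e2)
  · intro hs
    refine Scheme.IdealSheafData.le_ofIdeals_iff.2 fun V a ha => ?_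
    rw [RingHom.mem_ker]
    refine TopCat.Presheaf.section_ext T.sheaf _ _ _ fun t ht => ?_
    refine Eq.trans ?_ (map_zero (T.presheaf.germ (h ⁻¹ᵁ V.1) t ht).hom).symm
    refine (h.germ_stalkMap_apply V.1 t ht a).symm.trans ?_
    obtain ⟨c, hc⟩ := TopologicalSpace.Opens.mem_iSup.1 (hU.ge (Set.mem_univ (h t)))
    have h1 := mem_sectionsIdeal.1 ha (h t) ht
    rw [H.stalkIdeal_eq c _ hc] at h1
    refine (RingHom.mem_ker (f := (h.stalkMap t).hom)).1 (Ideal.span_le.2 ?_ h1)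
    rintro _ ⟨s, hsc, rfl⟩
    refine (RingHom.mem_ker (f := (h.stalkMap t).hom)).2 ?_
    refine (h.germ_stalkMap_apply (U c) t hc s).trans ?_
    refine (congrArg (T.presheaf.germ (h ⁻¹ᵁ U c) t hc).hom (hs c s hsc)).trans ?_
    exact map_zero _

end IdealSpan

end

section

/-! ### Coordinates of morphisms to projective space -/

theorem eval₂_mul_of_isHomogeneous {R L ι : Type*} [CommSemiring R] [CommSemiring L] (f : R →+* L)
    (g : ι → L) (u : L) {F : MvPolynomial ι R} {e : ℕ} (hF : F.IsHomogeneous e) :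
    eval₂ f (fun j => g j * u) F = eval₂ f g F * u ^ e := by
  rw [eval₂_eq, eval₂_eq, Finset.sum_mul]
  refine Finset.sum_congr rfl fun m hm => ?_
  have h1 : ∑ i ∈ m.support, m i = e := by
    have := hF (mem_support_iff.1 hm)
    simpa [Finsupp.weight_apply, Finsupp.sum] using this
  simp only [mul_pow, Finset.prod_mul_distrib, Finset.prod_pow_eq_pow_sum, h1, mul_assoc]

section Chart

variable {k : Type u} [Field k] {ι : Type}

theorem X_mem_grading (i : ι) : (X i : MvPolynomial ι k) ∈ grading k ι 1 :=
  (mem_homogeneousSubmodule 1 _).2 (isHomogeneous_X k i)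

/-- The dehomogenization `k[x] → k[x]_{(x_i)}`, `x_j ↦ x_j / x_i`. -/
def toAway (i : ι) :
    MvPolynomial ι k →+* HomogeneousLocalization.Away (grading k ι) (X i) :=
  eval₂Hom ((HomogeneousLocalization.fromZeroRingHom (grading k ι) _).comp
      (algebraMap k (grading k ι 0)))
    (fun j => HomogeneousLocalization.Away.mk (grading k ι) (X_mem_grading i) 1 (X j)
      (by simpa using X_mem_grading j))

/-- In the full localization, `toAway` substitutes `x_j · (1 / x_i)` for `x_j`, and homogeneity
pulls the factor `(1 / x_i) ^ e` out. -/
theorem toAway_eq_mk (i : ι) {e : ℕ} {F : MvPolynomial ι k} (hF : F.IsHomogeneous e) :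
    toAway i F = HomogeneousLocalization.Away.mk (grading k ι) (X_mem_grading i) e F
      ((mem_homogeneousSubmodule _ _).2 (by simpa using hF)) := by
  apply HomogeneousLocalization.val_injective
  rw [HomogeneousLocalization.Away.val_mk, ← HomogeneousLocalization.algebraMap_apply, toAway,
    coe_eval₂Hom, hom_eval₂]
  have h1 : (fun j => algebraMap (HomogeneousLocalization.Away (grading k ι) (X i))
      (Localization.Away (X i)) (HomogeneousLocalization.Away.mk (grading k ι) (X_mem_grading i) 1
        (X j) (by simpa using X_mem_grading j))) =
      fun j => algebraMap (MvPolynomial ι k) (Localization.Away (X i)) (X j) *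
        (Localization.mk 1 ⟨X i, Submonoid.mem_powers _⟩ : Localization (Submonoid.powers (X i : MvPolynomial ι k))) := by
    funext j
    rw [HomogeneousLocalization.algebraMap_apply, HomogeneousLocalization.Away.val_mk,
      ← Localization.mk_one_eq_algebraMap, Localization.mk_mul]
    congr 1
    simp
  have h2 : ∀ F : MvPolynomial ι k, eval₂ ((algebraMap (HomogeneousLocalization.Away (grading k ι)
      (X i)) (Localization.Away (X i : MvPolynomial ι k))).comp
      ((HomogeneousLocalization.fromZeroRingHom (grading k ι) _).comp
      (algebraMap k (grading k ι 0)))) (fun j => algebraMap (MvPolynomial ι k) _ (X j)) F =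
      algebraMap (MvPolynomial ι k) (Localization.Away (X i : MvPolynomial ι k)) F := by
    intro F
    rw [← coe_eval₂Hom]
    refine RingHom.congr_fun (MvPolynomial.ringHom_ext (fun a => ?_) (fun j => ?_)) F
    · rw [eval₂Hom_C]
      rfl
    · rw [eval₂Hom_X']
  rw [h1, eval₂_mul_of_isHomogeneous _ _ _ hF, h2, ← Localization.mk_one_eq_algebraMap,
    Localization.mk_pow, Localization.mk_mul]
  congr 1
  · simp
  · ext; simp

theorem toAway_surjective (i : ι) : Function.Surjective (toAway (k := k) i) := by
  intro a
  obtain ⟨e, F, hF, rfl⟩ := HomogeneousLocalization.Away.mk_surjective (grading k ι)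
    (X_mem_grading i) a
  exact ⟨F, toAway_eq_mk i (e := e) (by simpa using (mem_homogeneousSubmodule _ _).1 hF)⟩

/-- Replaces `dehom`, which depends on a degree, by a ring homomorphism, so that determinants and
sums can be pushed through it. -/
theorem dehom_eq (i : ι) {e : ℕ} {F : MvPolynomial ι k} (hF : F.IsHomogeneous e) :
    dehom i F hF = (Proj.awayToSection (grading k ι) (X i)).hom (toAway i F) := by
  rw [toAway_eq_mk i hF]
  rfl

theorem toAway_X_self (i : ι) : toAway (k := k) i (X i) = 1 := by
  rw [toAway_eq_mk i (isHomogeneous_X k i)]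
  apply HomogeneousLocalization.val_injective
  rw [HomogeneousLocalization.Away.val_mk, HomogeneousLocalization.val_one, Localization.mk_eq_mk',
    IsLocalization.mk'_eq_iff_eq_mul]
  simp

theorem iSup_chart_eq_top : ⨆ i : ι, chart k i = ⊤ := by
  refine Proj.iSup_basicOpen_eq_top' (grading k ι) _ (fun i => ⟨1, X_mem_grading i⟩) ?_
  rw [eq_top_iff]
  rintro F -
  induction F using MvPolynomial.induction_on with
  | C a => exact Subalgebra.algebraMap_mem _ (algebraMap k (grading k ι 0) a)
  | add p q hp hq => exact add_mem hp hq
  | mul_X p i hp => exact mul_mem hp (Algebra.subset_adjoin ⟨i, rfl⟩)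

/-- The element `F / x_i ^ e` of the homogeneous localization at a prime not containing `x_i`. -/
def fractionAt (P : Ideal (MvPolynomial ι k)) [P.IsPrime] (i : ι) (hp : X i ∉ P) {e : ℕ}
    (F : MvPolynomial ι k) (hF : F.IsHomogeneous e) :
    HomogeneousLocalization.AtPrime (grading k ι) P :=
  HomogeneousLocalization.mk ⟨e, ⟨F, (mem_homogeneousSubmodule _ _).2 hF⟩,
    ⟨X i ^ e, by simpa using SetLike.pow_mem_graded e (X_mem_grading (k := k) i)⟩,
    fun h => hp (Ideal.IsPrime.mem_of_pow_mem inferInstance e h)⟩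

theorem isUnit_fractionAt_iff (P : Ideal (MvPolynomial ι k)) [P.IsPrime] (i : ι) (hp : X i ∉ P)
    {e : ℕ} {F : MvPolynomial ι k} (hF : F.IsHomogeneous e) :
    IsUnit (fractionAt P i hp F hF) ↔ F ∉ P := by
  rw [← HomogeneousLocalization.isUnit_iff_isUnit_val, fractionAt, HomogeneousLocalization.val_mk,
    Localization.mk_eq_mk']
  exact IsLocalization.AtPrime.isUnit_mk'_iff (Localization.AtPrime P) P F _

theorem fractionAt_change (P : Ideal (MvPolynomial ι k)) [P.IsPrime] (i i' : ι) (hp : X i ∉ P)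
    (hp' : X i' ∉ P) {e : ℕ} {F : MvPolynomial ι k} (hF : F.IsHomogeneous e) :
    fractionAt P i hp F hF =
      fractionAt P i' hp' F hF * fractionAt P i hp (X i') (isHomogeneous_X k i') ^ e := by
  apply HomogeneousLocalization.val_injective
  rw [HomogeneousLocalization.val_mul, HomogeneousLocalization.val_pow]
  simp only [fractionAt, HomogeneousLocalization.val_mk]
  rw [Localization.mk_pow, Localization.mk_mul, Localization.mk_eq_mk_iff,
    Localization.r_iff_exists]
  refine ⟨1, ?_⟩
  simp
  ring

theorem mapId_mk (P : Ideal (MvPolynomial ι k)) [P.IsPrime] (i : ι) (hp : X i ∉ P) {e : ℕ}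
    {F : MvPolynomial ι k} (hF : F.IsHomogeneous e) :
    HomogeneousLocalization.mapId (grading k ι) (Submonoid.powers_le.mpr (show X i ∈ P.primeCompl from hp))
      (HomogeneousLocalization.Away.mk (grading k ι) (X_mem_grading i) e F
        ((mem_homogeneousSubmodule _ _).2 (by simpa using hF))) = fractionAt P i hp F hF := by
  apply HomogeneousLocalization.val_injective
  rfl

theorem germ_dehom (p : PP k ι) (i : ι) (hp : p ∈ chart k i) {e : ℕ} {F : MvPolynomial ι k}
    (hF : F.IsHomogeneous e) :
    ((PP k ι).presheaf.germ (chart k i) p hp).hom (dehom i F hF) =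
      (Proj.stalkIso' (grading k ι) p).symm (fractionAt (pointIdeal p) i hp F hF) := by
  have h2 := ProjectiveSpectrum.Proj.awayToSection_germ (grading k ι) (X i) p hp
  have h3 := congrArg (fun φ => φ.hom (HomogeneousLocalization.Away.mk (grading k ι)
    (X_mem_grading i) e F ((mem_homogeneousSubmodule _ _).2 (by simpa using hF)))) h2
  refine Eq.trans h3 ?_
  change (Proj.stalkIso' (grading k ι) p).symm (HomogeneousLocalization.mapId (grading k ι)
    (Submonoid.powers_le.mpr hp) (HomogeneousLocalization.Away.mk (grading k ι)
    (X_mem_grading i) e F ((mem_homogeneousSubmodule _ _).2 (by simpa using hF)))) = _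
  refine congrArg (Proj.stalkIso' (grading k ι) p).symm ?_
  exact mapId_mk (pointIdeal p) i hp hF

/-- The basic open subset of `F / x_i ^ e`. -/
theorem basicOpen_dehom (i : ι) {e : ℕ} {F : MvPolynomial ι k} (hF : F.IsHomogeneous e) :
    (PP k ι).basicOpen (dehom i F hF) = chart k i ⊓ Proj.basicOpen (grading k ι) F := by
  ext p
  by_cases hp : p ∈ chart k i
  swap
  · exact iff_of_false (fun h => hp ((PP k ι).basicOpen_le _ h)) (fun h => hp h.1)
  have h1 := (PP k ι).mem_basicOpen (dehom i F hF) p hp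
  have h5 : p ∈ (chart k i ⊓ Proj.basicOpen (grading k ι) F) ↔ F ∉ pointIdeal p :=
    ⟨fun h => h.2, fun h => ⟨hp, h⟩⟩
  refine h1.trans (Iff.trans ?_ h5.symm)
  have h6 := germ_dehom p i hp hF
  refine (iff_of_eq (congrArg IsUnit h6)).trans ?_
  exact (MulEquiv.isUnit_map (Proj.stalkIso' (grading k ι) p).symm).trans
    (isUnit_fractionAt_iff _ _ _ _)

theorem germ_dehom_change (p : PP k ι) (i i' : ι) (hp : p ∈ chart k i) (hp' : p ∈ chart k i')
    {e : ℕ} {F : MvPolynomial ι k} (hF : F.IsHomogeneous e) :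
    ((PP k ι).presheaf.germ (chart k i) p hp).hom (dehom i F hF) =
      ((PP k ι).presheaf.germ (chart k i') p hp').hom (dehom i' F hF) *
      ((PP k ι).presheaf.germ (chart k i) p hp).hom (dehom i (X i') (isHomogeneous_X k i')) ^ e := by
  rw [germ_dehom, germ_dehom, germ_dehom]
  exact Eq.trans (congrArg (Proj.stalkIso' (grading k ι) p).symm (fractionAt_change (pointIdeal p) i i' hp hp' hF))
    ((map_mul (Proj.stalkIso' (grading k ι) p).symm _ _).trans (congrArg _
      (map_pow (Proj.stalkIso' (grading k ι) p).symm _ e)))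

theorem le_preimage_top {Y Z : Scheme.{u}} (f : Y ⟶ Z) (U : Y.Opens) : U ≤ f ⁻¹ᵁ ⊤ :=
  fun _ _ => trivial

theorem appLE_top {Y Z : Scheme.{u}} (f : Y ⟶ Z) :
    f.appLE ⊤ ⊤ (le_preimage_top f ⊤) = f.appTop := by
  rw [Scheme.Hom.appTop, Scheme.Hom.app_eq_appLE]
  rfl

theorem ι_appLE_top {Y : Scheme.{u}} (U : Y.Opens) (h : ⊤ ≤ U.ι ⁻¹ᵁ U) :
    U.ι.appLE U ⊤ h = U.topIso.inv := by
  rw [Scheme.Hom.appLE, Scheme.Opens.ι_app, Scheme.Opens.topIso_inv]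
  exact (Y.presheaf.map_comp _ _).symm

/-- The inclusion of the chart `x_i ≠ 0`. -/
abbrev chartι (i : ι) :
    Spec (.of (HomogeneousLocalization.Away (grading k ι) (X i))) ⟶ PP k ι :=
  Proj.awayι (grading k ι) (X i) (X_mem_grading (k := k) i) one_pos

theorem chartι_le (i : ι) : ⊤ ≤ chartι (k := k) i ⁻¹ᵁ chart k i := by
  intro x _
  have : chartι i x ∈ (chartι (k := k) i).opensRange := ⟨x, rfl⟩
  rwa [Proj.opensRange_awayι] at this

/-- The two identifications of the functions on the chart with the ring of degree-zero fractions
agree: the one given by `Proj.awayToSection` and the one given by the chart as a spectrum. -/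
theorem chartι_appLE (i : ι) :
    Proj.awayToSection (grading k ι) (X i) ≫ (chartι i).appLE (chart k i) ⊤ (chartι_le i) =
      (Scheme.ΓSpecIso _).inv := by
  let e : (chart k i).toScheme ≅ _ :=
    Proj.basicOpenIsoSpec (grading k ι) (X i) (X_mem_grading i) one_pos
  have h1 : Proj.awayToSection (grading k ι) (X i) ≫ (chart k i).topIso.inv =
      (Scheme.ΓSpecIso _).inv ≫ e.hom.appTop :=
    (Iso.eq_inv_comp _).2 (Proj.basicOpenToSpec_app_top (grading k ι) (X i)).symm
  have h3 : e.hom ≫ chartι i = (chart k i).ι := by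
    rw [chartι, Proj.awayι, Iso.hom_inv_id_assoc]
  have h4 : (chartι i).appLE (chart k i) ⊤ (chartι_le i) ≫ e.hom.appTop =
      (chart k i).topIso.inv := by
    rw [← appLE_top e.hom, ← ι_appLE_top (chart k i) (by simp), Scheme.Hom.appLE_comp_appLE]
    simp only [h3]
  have h5 : e.hom.appTop ≫ e.inv.appTop = 𝟙 _ := by
    rw [← Scheme.Hom.comp_appTop, e.inv_hom_id, Scheme.Hom.id_appTop]
  rw [← Category.comp_id ((chartι i).appLE _ _ _), ← h5, ← Category.assoc ((chartι i).appLE _ _ _),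
    h4, ← Category.assoc, h1, Category.assoc, h5, Category.comp_id]

/-- The dehomogenization with values in the sections over the chart `x_i ≠ 0`. -/
def chartHom (i : ι) : CommRingCat.of (MvPolynomial ι k) ⟶ Γ(PP k ι, chart k i) :=
  CommRingCat.ofHom (toAway i) ≫ Proj.awayToSection (grading k ι) (X i)

theorem chart_ι_toSpec (i : ι) : (chart k i).ι ≫ PP.toSpec k ι =
    (chart k i).toSpecΓ ≫ Spec.map (CommRingCat.ofHom C ≫ chartHom i) := by
  have h1 : (chart k i).ι = (Proj.basicOpenIsoSpec (grading k ι) (X i) (X_mem_grading i)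
      one_pos).hom ≫ Proj.awayι (grading k ι) (X i) (X_mem_grading i) one_pos := by
    rw [Proj.awayι, Iso.hom_inv_id_assoc]
  rw [h1, PP.toSpec, Category.assoc, Proj.awayι_toSpecZero_assoc, Proj.basicOpenIsoSpec_hom,
    Proj.basicOpenToSpec, Category.assoc, ← Spec.map_comp, ← Spec.map_comp]
  congr 2
  rw [chartHom, ← Category.assoc, ← CommRingCat.ofHom_comp,
    ← CommRingCat.ofHom_comp, toAway, eval₂Hom_comp_C]

theorem appLE_eq_of_ι_comp {Y : Scheme.{u}} (U : Y.Opens) {R : CommRingCat.{u}} (f : Y ⟶ Spec R)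
    (ψ : R ⟶ Γ(Y, U)) (h : U.ι ≫ f = U.toSpecΓ ≫ Spec.map ψ) :
    (Scheme.ΓSpecIso R).inv ≫ f.appLE ⊤ U (le_preimage_top f U) = ψ := by
  have h3 : f.appLE ⊤ U (le_preimage_top f U) ≫ U.topIso.inv = (U.ι ≫ f).appTop := by
    rw [← ι_appLE_top U (by simp), Scheme.Hom.appLE_comp_appLE, appLE_top]
  rw [← cancel_mono U.topIso.inv, Category.assoc, h3, h, Scheme.Hom.comp_appTop,
    Scheme.Opens.toSpecΓ_appTop, Scheme.ΓSpecIso_naturality_assoc, Iso.inv_hom_id_assoc]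

/-! ### Evaluation of polynomials at scheme-valued points of projective space. -/

variable {T : Scheme.{u}}

/-- The action of scalars on the sections of a scheme over `k`. -/
def scalarHom (t : T ⟶ Spec (.of k)) (U : T.Opens) : k →+* Γ(T, U) :=
  ((Scheme.ΓSpecIso (.of k)).inv ≫ t.appLE ⊤ U (le_preimage_top t U)).hom

/-- The pullback `F ↦ F(y) / y_i ^ e` of dehomogenized polynomials along a morphism `y` to
projective space, on an open set where `y_i ≠ 0`. -/
def evalAt (y : T ⟶ PP k ι) (i : ι) (U : T.Opens) (hU : U ≤ y ⁻¹ᵁ chart k i) :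
    MvPolynomial ι k →+* Γ(T, U) :=
  (chartHom i ≫ y.appLE (chart k i) U hU).hom

theorem evalAt_X_self (y : T ⟶ PP k ι) (i : ι) (U : T.Opens) (hU : U ≤ y ⁻¹ᵁ chart k i) :
    evalAt y i U hU (X i) = 1 := by
  simp [evalAt, chartHom, toAway_X_self]

theorem evalAt_res (y : T ⟶ PP k ι) (i : ι) {U V : T.Opens} (hU : U ≤ y ⁻¹ᵁ chart k i)
    (h : V ≤ U) (F : MvPolynomial ι k) :
    (T.presheaf.map (homOfLE h).op).hom (evalAt y i U hU F) = evalAt y i V (h.trans hU) F := by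
  rw [evalAt, ← CommRingCat.comp_apply, Category.assoc, Scheme.Hom.appLE_map]
  rfl

theorem evalAt_comp {T' : Scheme.{u}} (g : T' ⟶ T) (y : T ⟶ PP k ι) (i : ι) {U : T.Opens}
    (hU : U ≤ y ⁻¹ᵁ chart k i) {V : T'.Opens} (h : V ≤ g ⁻¹ᵁ U) (F : MvPolynomial ι k) :
    (g.appLE U V h).hom (evalAt y i U hU F) = evalAt (g ≫ y) i V (fun _ hx => hU (h hx)) F := by
  rw [evalAt, ← CommRingCat.comp_apply, Category.assoc, Scheme.Hom.appLE_comp_appLE]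
  rfl

theorem app_dehom (y : T ⟶ PP k ι) (i : ι) {e : ℕ} {F : MvPolynomial ι k}
    (hF : F.IsHomogeneous e) :
    (y.app (chart k i)).hom (dehom i F hF) = evalAt y i (y ⁻¹ᵁ chart k i) le_rfl F := by
  rw [evalAt, Scheme.Hom.appLE_eq_app, dehom_eq]
  rfl

theorem appLE_dehom (y : T ⟶ PP k ι) (i : ι) {e : ℕ} {F : MvPolynomial ι k}
    (hF : F.IsHomogeneous e) (U : T.Opens) (hU : U ≤ y ⁻¹ᵁ chart k i) :
    (y.appLE (chart k i) U hU).hom (dehom i F hF) = evalAt y i U hU F := by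
  rw [evalAt, dehom_eq]
  rfl

theorem basicOpen_evalAt (y : T ⟶ PP k ι) (i : ι) (U : T.Opens) (hU : U ≤ y ⁻¹ᵁ chart k i)
    {e : ℕ} {F : MvPolynomial ι k} (hF : F.IsHomogeneous e) {t : T} (ht : t ∈ U) :
    t ∈ T.basicOpen (evalAt y i U hU F) ↔ F ∉ pointIdeal (y t) := by
  rw [← appLE_dehom y i hF U hU]
  erw [Scheme.basicOpen_appLE]
  rw [basicOpen_dehom]
  exact ⟨fun h => h.2.2, fun h => ⟨ht, hU ht, h⟩⟩

theorem evalAt_C (y : T ⟶ PP k ι) (i : ι) (U : T.Opens) (hU : U ≤ y ⁻¹ᵁ chart k i) (a : k) :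
    evalAt y i U hU (C a) = scalarHom (y ≫ PP.toSpec k ι) U a := by
  have h1 := appLE_eq_of_ι_comp _ _ _ (chart_ι_toSpec (k := k) i)
  rw [scalarHom, ← Scheme.Hom.appLE_comp_appLE y (PP.toSpec k ι) ⊤ (chart k i) U
      (le_preimage_top _ _) hU,
    ← Category.assoc, h1]
  rfl

theorem evalAt_eq_eval₂ (y : T ⟶ PP k ι) (i : ι) (U : T.Opens) (hU : U ≤ y ⁻¹ᵁ chart k i)
    (F : MvPolynomial ι k) : evalAt y i U hU F =
      eval₂ (scalarHom (y ≫ PP.toSpec k ι) U) (fun j => evalAt y i U hU (X j)) F := by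
  rw [← coe_eval₂Hom]
  refine RingHom.congr_fun (MvPolynomial.ringHom_ext (fun a => ?_) (fun j => ?_)) F
  · rw [eval₂Hom_C, evalAt_C]
  · rw [eval₂Hom_X']

/-- The transition rule between charts, checked on germs. It makes the vanishing of a form
independent of the chart, so that equations may be tested in any one chart containing the image. -/
theorem evalAt_change (y : T ⟶ PP k ι) (i i' : ι) (U : T.Opens) (hU : U ≤ y ⁻¹ᵁ chart k i)
    (hU' : U ≤ y ⁻¹ᵁ chart k i') {e : ℕ} {F : MvPolynomial ι k} (hF : F.IsHomogeneous e) :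
    evalAt y i U hU F = evalAt y i' U hU' F * evalAt y i U hU (X i') ^ e := by
  refine TopCat.Presheaf.section_ext T.sheaf _ _ _ fun t ht => ?_
  have key : ∀ (i : ι) (hU : U ≤ y ⁻¹ᵁ chart k i) {e : ℕ} {F : MvPolynomial ι k}
      (hF : F.IsHomogeneous e), (T.presheaf.germ U t ht).hom (evalAt y i U hU F) =
        (y.stalkMap t).hom (((PP k ι).presheaf.germ (chart k i) (y t) (hU ht)).hom
          (dehom i F hF)) := by
    intro i hU e F hF
    refine Eq.trans ?_ (y.germ_stalkMap_apply (chart k i) t (hU ht) (dehom i F hF)).symm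
    refine Eq.trans ?_ (congrArg (T.presheaf.germ (y ⁻¹ᵁ chart k i) t (hU ht)).hom
      (app_dehom y i hF)).symm
    rw [← evalAt_res y i le_rfl hU, germ_res_hom]
  have h1 := germ_dehom_change (y t) i i' (hU ht) (hU' ht) hF
  refine (key i hU hF).trans ?_
  refine Eq.trans ?_ (map_mul (T.presheaf.germ U t ht).hom _ _).symm
  rw [map_pow, key i' hU' hF, key i hU (isHomogeneous_X k i'), h1, map_mul, map_pow]

theorem evalAt_comp_chartι (i : ι)
    (z : T ⟶ Spec (.of (HomogeneousLocalization.Away (grading k ι) (X i))))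
    (h : ⊤ ≤ (z ≫ chartι i) ⁻¹ᵁ chart k i) (F : MvPolynomial ι k) :
    evalAt (z ≫ chartι i) i ⊤ h F =
      ((Scheme.ΓSpecIso _).inv ≫ z.appTop).hom (toAway i F) := by
  have h1 := evalAt_comp z (chartι i) i (chartι_le i) (le_preimage_top z ⊤) F
  have h2 : chartHom i ≫ (chartι (k := k) i).appLE (chart k i) ⊤ (chartι_le i) =
      CommRingCat.ofHom (toAway i) ≫ (Scheme.ΓSpecIso _).inv := by
    rw [chartHom, Category.assoc, chartι_appLE]
  refine h1.symm.trans ?_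
  rw [evalAt, h2, appLE_top]
  rfl

/-- Since `φ` sends `x_i` to a unit it extends to the full localization, and restricting to degree
zero loses nothing because `φ (X i) = 1`. -/
theorem exists_comp_toAway {R : Type*} [CommRing R] (i : ι) (φ : MvPolynomial ι k →+* R)
    (hφ : φ (X i) = 1) :
    ∃ ψ : HomogeneousLocalization.Away (grading k ι) (X i) →+* R, ψ.comp (toAway i) = φ := by
  have hu : IsUnit (φ (X i)) := by simp [hφ]
  let L := Localization.Away (X i : MvPolynomial ι k)
  let ψ' : L →+* R := IsLocalization.Away.lift (X i) hu
  have hψ' : ∀ F, ψ' (algebraMap _ L F) = φ F := IsLocalization.Away.lift_eq (X i) hu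
  refine ⟨ψ'.comp (algebraMap _ L), MvPolynomial.ringHom_ext (fun a => ?_) (fun j => ?_)⟩
  · have h1 : algebraMap (HomogeneousLocalization.Away (grading k ι) (X i)) L (toAway i (C a)) =
        algebraMap (MvPolynomial ι k) L (C a) := by
      rw [toAway, eval₂Hom_C]
      rfl
    rw [RingHom.comp_apply, RingHom.comp_apply, h1, hψ']
  · have h1 : algebraMap (HomogeneousLocalization.Away (grading k ι) (X i)) L (toAway i (X j)) *
        algebraMap (MvPolynomial ι k) L (X i) = algebraMap (MvPolynomial ι k) L (X j) := by
      rw [toAway_eq_mk i (isHomogeneous_X k j), HomogeneousLocalization.algebraMap_apply,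
        HomogeneousLocalization.Away.val_mk, ← Localization.mk_one_eq_algebraMap,
        ← Localization.mk_one_eq_algebraMap, Localization.mk_mul, Localization.mk_eq_mk_iff,
        Localization.r_iff_exists]
      exact ⟨1, by simp [mul_comm]⟩
    have h2 := congrArg ψ' h1
    rw [map_mul, hψ', hψ', hφ, mul_one] at h2
    exact h2

theorem exists_hom_appTop {R : CommRingCat.{u}} (ψ : R ⟶ Γ(T, ⊤)) :
    ∃ z : T ⟶ Spec R, (Scheme.ΓSpecIso R).inv ≫ z.appTop = ψ := by
  refine ⟨T.toSpecΓ ≫ Spec.map ψ, ?_⟩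
  rw [Scheme.Hom.comp_appTop, Scheme.toSpecΓ_appTop, Scheme.ΓSpecIso_naturality,
    Iso.inv_hom_id_assoc]

/-- Construction of a morphism to projective space from its affine coordinates. -/
theorem exists_hom_of_coordinates (t : T ⟶ Spec (.of k)) (i : ι) (c : ι → Γ(T, ⊤))
    (hc : c i = 1) : ∃ (y : T ⟶ PP k ι) (h : ⊤ ≤ y ⁻¹ᵁ chart k i),
      y ≫ PP.toSpec k ι = t ∧ ∀ j, evalAt y i ⊤ h (X j) = c j := by
  obtain ⟨ψ, hψ⟩ := exists_comp_toAway i (eval₂Hom (scalarHom t ⊤) c) (by simp [hc])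
  obtain ⟨z, hz⟩ := exists_hom_appTop (CommRingCat.ofHom ψ)
  have hy : ⊤ ≤ (z ≫ chartι i) ⁻¹ᵁ chart k i := by
    rw [Scheme.Hom.comp_preimage]
    exact (le_preimage_top z ⊤).trans ((TopologicalSpace.Opens.map z.base).map
      (homOfLE (chartι_le i))).le
  have hev : ∀ F, evalAt (z ≫ chartι i) i ⊤ hy F = eval₂Hom (scalarHom t ⊤) c F := by
    intro F
    rw [evalAt_comp_chartι, hz, ← hψ]
    rfl
  refine ⟨z ≫ chartι i, hy, ?_, fun j => (hev _).trans (eval₂Hom_X' _ _ _)⟩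
  refine ext_of_isAffine ?_
  rw [← cancel_epi (Scheme.ΓSpecIso (.of k)).inv]
  ext a
  have h1 := hev (C a)
  rw [evalAt_C, eval₂Hom_C, scalarHom, scalarHom, appLE_top, appLE_top] at h1
  exact h1

/-- A morphism to a chart of projective space is determined by its coordinates. -/
theorem hom_ext_of_evalAt {y y' : T ⟶ PP k ι} (i : ι) (h : ⊤ ≤ y ⁻¹ᵁ chart k i)
    (h' : ⊤ ≤ y' ⁻¹ᵁ chart k i) (hk : y ≫ PP.toSpec k ι = y' ≫ PP.toSpec k ι)
    (hX : ∀ j, evalAt y i ⊤ h (X j) = evalAt y' i ⊤ h' (X j)) : y = y' := by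
  have key : ∀ y : T ⟶ PP k ι, ⊤ ≤ y ⁻¹ᵁ chart k i →
      ∃ z : T ⟶ Spec (.of (HomogeneousLocalization.Away (grading k ι) (X i))), z ≫ chartι i = y := by
    intro y h
    refine ⟨IsOpenImmersion.lift (chartι i) y ?_, IsOpenImmersion.lift_fac _ _ _⟩
    rintro _ ⟨x, rfl⟩
    have : y x ∈ (chartι (k := k) i).opensRange := by
      rw [Proj.opensRange_awayι]
      exact h (Set.mem_univ x)
    exact this
  have hev : ∀ F, evalAt y i ⊤ h F = evalAt y' i ⊤ h' F := by
    intro F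
    rw [evalAt_eq_eval₂, evalAt_eq_eval₂ y', hk]
    simp only [hX]
  obtain ⟨z, rfl⟩ := key y h
  obtain ⟨z', rfl⟩ := key y' h'
  suffices z = z' by rw [this]
  refine ext_of_isAffine ?_
  rw [← cancel_epi (Scheme.ΓSpecIso _).inv]
  ext a
  obtain ⟨F, rfl⟩ := toAway_surjective i a
  have := hev F
  rwa [evalAt_comp_chartι, evalAt_comp_chartι] at this

end Chart

end

section

/-! ### Symmetric matrices of corank one -/

section Corank

variable {R : Type*} [CommRing R] {m : Type*} [Fintype m] [DecidableEq m]

/-- Replacing row `i` of `M` by the `i`-th unit vector gives a matrix that still kills `y` and whose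
determinant is `M.adjugate i i`. -/
theorem eq_zero_of_mulVec_eq_zero {M : Matrix m m R} {i : m} (ha : IsUnit (M.adjugate i i))
    {y : m → R} (hy : M.mulVec y = 0) (hi : y i = 0) : y = 0 := by
  have h1 : (M.updateRow i (Pi.single i 1)).mulVec y = 0 := by
    funext s
    by_cases hs : s = i
    · subst hs
      simp [Matrix.mulVec, hi]
    · have := congrFun hy s
      simpa [Matrix.mulVec, Matrix.updateRow_ne hs] using this
  have h2 : IsUnit (M.updateRow i (Pi.single i 1)).det := by
    rwa [← Matrix.adjugate_apply]
  have h3 := congrArg ((M.updateRow i (Pi.single i 1))⁻¹.mulVec) h1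
  rwa [Matrix.mulVec_mulVec, Matrix.nonsing_inv_mul _ h2, Matrix.one_mulVec,
    Matrix.mulVec_zero] at h3

theorem mulVec_adjugate_col {M : Matrix m m R} (hM : M.det = 0) (j : m) :
    M.mulVec (fun s => M.adjugate s j) = 0 := by
  funext s
  have := congrFun (congrFun (Matrix.mul_adjugate M) s) j
  rw [hM, zero_smul] at this
  exact this

/-- The kernel of a symmetric matrix of corank one is generated by a column of the adjugate. -/
theorem eq_smul_adjugate_of_mulVec_eq_zero {M : Matrix m m R} (hM : M.det = 0) {i : m}
    (ha : IsUnit (M.adjugate i i)) {y : m → R} (hy : M.mulVec y = 0) (s : m) :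
    M.adjugate i i * y s = M.adjugate s i * y i := by
  have h1 : M.mulVec (M.adjugate i i • y - y i • fun s => M.adjugate s i) = 0 := by
    rw [Matrix.mulVec_sub, Matrix.mulVec_smul, Matrix.mulVec_smul, hy, mulVec_adjugate_col hM,
      smul_zero, smul_zero, sub_zero]
  have h2 := congrFun (eq_zero_of_mulVec_eq_zero ha h1 (by simp [mul_comm])) s
  simp only [Pi.sub_apply, Pi.smul_apply, smul_eq_mul, Pi.zero_apply, sub_eq_zero] at h2
  rw [h2, mul_comm]

theorem adjugate_symm {M : Matrix m m R} (hs : M.IsSymm) (s t : m) :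
    M.adjugate s t = M.adjugate t s := by
  have : (M.adjugate).transpose = M.adjugate := by
    rw [Matrix.adjugate_transpose, hs]
  exact (congrFun (congrFun this t) s)

/-- The adjugate of a symmetric matrix of corank one has rank one. -/
theorem adjugate_mul_adjugate {M : Matrix m m R} (hM : M.det = 0) (hs : M.IsSymm) {i : m}
    (ha : IsUnit (M.adjugate i i)) (s t : m) :
    M.adjugate i i * M.adjugate s t = M.adjugate s i * M.adjugate t i := by
  rw [eq_smul_adjugate_of_mulVec_eq_zero hM ha (mulVec_adjugate_col hM t), adjugate_symm hs i t]

end Corank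

/-! ### The derivative of a determinant -/

theorem derivation_prod {R A ι : Type*} [CommRing R] [CommRing A] [Algebra R A] [DecidableEq ι]
    (D : Derivation R A A) (s : Finset ι) (f : ι → A) :
    D (∏ i ∈ s, f i) = ∑ i ∈ s, (∏ j ∈ s.erase i, f j) * D (f i) := by
  induction s using Finset.induction_on with
  | empty => simp
  | insert a s ha ih =>
    rw [Finset.prod_insert ha, Derivation.leibniz, ih, Finset.sum_insert ha,
      Finset.erase_insert ha, smul_eq_mul, smul_eq_mul, Finset.mul_sum, add_comm]
    congr 1
    refine Finset.sum_congr rfl fun i hi => ?_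
    have hne : a ≠ i := fun h => ha (h ▸ hi)
    rw [Finset.erase_insert_of_ne hne, Finset.prod_insert fun h => ha (Finset.mem_of_mem_erase h),
      mul_assoc]

/-- Jacobi's formula: differentiate one column at a time and evaluate each resulting determinant by
Cramer's rule. -/
theorem derivation_det {R A : Type*} [CommRing R] [CommRing A] [Algebra R A] {m : Type*}
    [Fintype m] [DecidableEq m] (D : Derivation R A A) (M : Matrix m m A) :
    D M.det = ∑ s, ∑ t, M.adjugate s t * D (M t s) := by
  have h1 : D M.det = ∑ s, (M.updateCol s fun t => D (M t s)).det := by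
    simp only [Matrix.det_apply, map_sum]
    rw [Finset.sum_comm]
    refine Finset.sum_congr rfl fun σ _ => ?_
    rw [← Finset.smul_sum, Units.smul_def, Units.smul_def, map_zsmul]
    congr 1
    rw [derivation_prod]
    refine Finset.sum_congr rfl fun s _ => ?_
    rw [← Finset.mul_prod_erase _ _ (Finset.mem_univ s), Matrix.updateCol_self, mul_comm]
    congr 1
    refine Finset.prod_congr rfl fun t ht => ?_
    rw [Matrix.updateCol_ne (Finset.ne_of_mem_erase ht)]
  rw [h1]
  refine Finset.sum_congr rfl fun s _ => ?_
  rw [← Matrix.cramer_apply, Matrix.cramer_eq_adjugate_mulVec]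
  rfl

/-! ### Left kernels of matrices with vanishing maximal minors -/

section LeftKernel

variable {R : Type*} [CommRing R] {r : ℕ} {n : Type*}

/-- The maximal minors of a matrix with a left kernel vector that has a unit entry vanish. -/
theorem det_eq_zero_of_vecMul_eq_zero {r : ℕ} {J : Matrix (Fin r) n R} {w : Fin r → R}
    (hw : ∀ j, ∑ l, w l * J l j = 0) {l : Fin r} (hl : IsUnit (w l)) (e : Fin r → n) :
    (J.submatrix id e).det = 0 := by
  have h1 : Matrix.vecMul w (J.submatrix id e) = 0 := by
    funext j
    exact hw (e j)
  have h2 := congrArg (fun v => Matrix.vecMul v (J.submatrix id e).adjugate) h1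
  simp only [Matrix.vecMul_vecMul, Matrix.mul_adjugate, Matrix.zero_vecMul, Matrix.vecMul_smul,
    Matrix.vecMul_one] at h2
  have h3 := congrFun h2 l
  simp only [Pi.smul_apply, smul_eq_mul, Pi.zero_apply] at h3
  exact (hl.mul_left_eq_zero).1 h3

/-- The vector of signed maximal minors of `J.submatrix id e`, which is orthogonal to the columns
of `J` if the maximal minors of `J` vanish. -/
def minorVector (J : Matrix (Fin (r + 1)) n R) (e : Fin r → n) (l : Fin (r + 1)) : R :=
  (-1) ^ (l : ℕ) * (J.submatrix l.succAbove e).det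

/-- The sum is the Laplace expansion, along its first column, of the maximal minor with columns `j`
and `e`. -/
theorem minorVector_vecMul {J : Matrix (Fin (r + 1)) n R}
    (hJ : ∀ e : Fin (r + 1) → n, (J.submatrix id e).det = 0) (e : Fin r → n) (j : n) :
    ∑ l, minorVector J e l * J l j = 0 := by
  rw [← hJ (Fin.cons j e), Matrix.det_succ_column_zero]
  refine Finset.sum_congr rfl fun l _ => ?_
  have : (J.submatrix id (Fin.cons j e : Fin (r + 1) → n)).submatrix l.succAbove Fin.succ =
      J.submatrix l.succAbove e := by
    ext a b
    simp
  rw [this, minorVector]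
  simp only [Matrix.submatrix_apply, id_eq, Fin.cons_zero]
  ring

/-- Once `w l = 0`, the other coordinates form a left kernel vector of the invertible square matrix
obtained by omitting row `l`. -/
theorem eq_zero_of_vecMul_eq_zero {J : Matrix (Fin (r + 1)) n R} {e : Fin r → n}
    {l : Fin (r + 1)} (hl : IsUnit (minorVector J e l)) {w : Fin (r + 1) → R}
    (hw : ∀ j, ∑ i, w i * J i j = 0) (hwl : w l = 0) : w = 0 := by
  have hu : IsUnit (J.submatrix l.succAbove e).det := isUnit_of_mul_isUnit_right hl
  have h1 : Matrix.vecMul (fun i => w (l.succAbove i)) (J.submatrix l.succAbove e) = 0 := by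
    funext j
    have := hw (e j)
    rw [Fin.sum_univ_succAbove _ l, hwl, zero_mul, zero_add] at this
    exact this
  have h2 := congrArg (fun v => Matrix.vecMul v (J.submatrix l.succAbove e)⁻¹) h1
  simp only [Matrix.vecMul_vecMul, Matrix.mul_nonsing_inv _ hu, Matrix.zero_vecMul,
    Matrix.vecMul_one] at h2
  funext i
  rcases Fin.eq_self_or_eq_succAbove l i with rfl | ⟨j, rfl⟩
  · exact hwl
  · exact congrFun h2 j

/-- The left kernel of a matrix of rank one less than the number of rows is generated by a vector
of minors. -/
theorem mul_minorVector_of_vecMul_eq_zero {J : Matrix (Fin (r + 1)) n R}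
    (hJ : ∀ e : Fin (r + 1) → n, (J.submatrix id e).det = 0) {e : Fin r → n}
    {l : Fin (r + 1)} (hl : IsUnit (minorVector J e l)) {w : Fin (r + 1) → R}
    (hw : ∀ j, ∑ i, w i * J i j = 0) (i : Fin (r + 1)) :
    minorVector J e l * w i = minorVector J e i * w l := by
  have h1 := eq_zero_of_vecMul_eq_zero hl
    (w := fun i => minorVector J e l * w i - minorVector J e i * w l) (fun j => by
      simp only [sub_mul, Finset.sum_sub_distrib]
      have e1 : ∑ i, minorVector J e l * w i * J i j = minorVector J e l * ∑ i, w i * J i j := by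
        rw [Finset.mul_sum]
        exact Finset.sum_congr rfl fun _ _ => by ring
      have e2 : ∑ i, minorVector J e i * w l * J i j = w l * ∑ i, minorVector J e i * J i j := by
        rw [Finset.mul_sum]
        exact Finset.sum_congr rfl fun _ _ => by ring
      rw [e1, e2, hw, minorVector_vecMul hJ, mul_zero, mul_zero, sub_zero]) (by ring)
  exact sub_eq_zero.1 (congrFun h1 i)

end LeftKernel

/-! ### Ranks and minors over a field -/

section Rank

variable {K : Type*} [Field K]

theorem exists_succAbove_comp {m : ℕ} {e : Fin m → Fin (m + 1)} (he : Function.Injective e) :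
    ∃ (i : Fin (m + 1)) (σ : Equiv.Perm (Fin m)), e = i.succAbove ∘ σ := by
  obtain ⟨i, hi⟩ : ∃ i, i ∉ Set.range e := by
    by_contra! h
    have := Fintype.card_le_of_surjective e h
    simp at this
  choose g hg using fun x => Fin.exists_succAbove_eq (x := e x) (y := i) fun h => hi ⟨x, h⟩
  have hinj : Function.Injective g := fun x y h => he (by rw [← hg, ← hg, h])
  exact ⟨i, Equiv.ofBijective g ((Finite.injective_iff_bijective).1 hinj),
    funext fun x => (hg x).symm⟩

theorem injective_of_det_ne_zero {a b : Type*} {m : ℕ} {M : Matrix a b K} {e : Fin m → a}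
    {e' : Fin m → b} (h : (M.submatrix e e').det ≠ 0) : Function.Injective e := by
  intro x y hxy
  by_contra hne
  exact h (Matrix.det_zero_of_row_eq hne (by funext j; simp [hxy]))

theorem exists_minor_succAbove {b : Type*} [Fintype b] {m : ℕ} {M : Matrix (Fin (m + 1)) b K}
    (h : m ≤ M.rank) : ∃ (i : Fin (m + 1)) (e : Fin m → b),
      (M.submatrix i.succAbove e).det ≠ 0 := by
  obtain ⟨e, e', he⟩ := exists_minor M h
  obtain ⟨i, σ, rfl⟩ := exists_succAbove_comp (injective_of_det_ne_zero he)
  refine ⟨i, e', fun h0 => he ?_⟩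
  have : M.submatrix (i.succAbove ∘ σ) e' = (M.submatrix i.succAbove e').submatrix σ id := rfl
  rw [this, Matrix.det_permute, h0, mul_zero]

/-- The entries of the adjugate are, up to sign, the minors of size `d - 1`. The index maps supplied
by the rank are injective, hence the omission of one row or column up to a permutation. -/
theorem adjugate_ne_zero_of_le_rank {d : ℕ} {M : Matrix (Fin d) (Fin d) K} (hd : d ≠ 0)
    (h : d ≤ M.rank + 1) : M.adjugate ≠ 0 := by
  obtain ⟨m, rfl⟩ := Nat.exists_eq_succ_of_ne_zero hd
  obtain ⟨i, e, he⟩ := exists_minor_succAbove (M := M) (by simpa using h)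
  have he' : (M.transpose.submatrix e i.succAbove).det ≠ 0 := by
    rwa [← Matrix.det_transpose] at he
  obtain ⟨j, σ, rfl⟩ := exists_succAbove_comp (injective_of_det_ne_zero he')
  intro h0
  apply he
  have h1 : M.submatrix i.succAbove (j.succAbove ∘ σ) =
    (M.submatrix i.succAbove j.succAbove).submatrix id σ := rfl
  have h2 := congrFun (congrFun h0 j) i
  rw [Matrix.adjugate_fin_succ_eq_det_submatrix] at h2
  rw [h1, Matrix.det_permute']
  have h3 : (M.submatrix i.succAbove j.succAbove).det = 0 := by simpa using h2
  rw [h3, mul_zero]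

/-- A singular symmetric matrix of corank at most one has a nonzero principal minor of maximal
size. -/
theorem exists_adjugate_apply_self_ne_zero {d : ℕ} {M : Matrix (Fin d) (Fin d) K} (hd : d ≠ 0)
    (hs : M.IsSymm) (hM : M.det = 0) (h : d ≤ M.rank + 1) : ∃ i, M.adjugate i i ≠ 0 := by
  have h0 := adjugate_ne_zero_of_le_rank hd h
  obtain ⟨i, j, hij⟩ : ∃ i j, M.adjugate i j ≠ 0 := by
    by_contra! h1
    exact h0 (by ext i j; exact h1 i j)
  -- The kernel of `M` is at most a line and contains every column of the adjugate, so the adjugate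
  -- has rank one. With symmetry this gives `adj_ij² = adj_ii · adj_jj`, which a zero diagonal would
  -- annihilate.
  by_contra! hdiag
  have hker : Module.finrank K (LinearMap.ker M.mulVecLin) ≤ 1 := by
    have := M.mulVecLin.finrank_range_add_finrank_ker
    rw [Module.finrank_fin_fun] at this
    have h2 : M.rank = Module.finrank K (LinearMap.range M.mulVecLin) := rfl
    omega
  have hmem : ∀ t, (fun s => M.adjugate s t) ∈ LinearMap.ker M.mulVecLin := fun t =>
    mulVec_adjugate_col hM t
  have hne : (⟨_, hmem j⟩ : LinearMap.ker M.mulVecLin) ≠ 0 := fun h1 =>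
    hij (congrFun (congrArg Subtype.val h1) i)
  obtain ⟨c, hc⟩ := (finrank_le_one_iff.1 hker)
  obtain ⟨a, ha⟩ := hc ⟨_, hmem i⟩
  obtain ⟨b, hb⟩ := hc ⟨_, hmem j⟩
  have ha' : ∀ s, a * c.1 s = M.adjugate s i := fun s => congrFun (congrArg Subtype.val ha) s
  have hb' : ∀ s, b * c.1 s = M.adjugate s j := fun s => congrFun (congrArg Subtype.val hb) s
  have h1 : M.adjugate i j * M.adjugate j i = M.adjugate i i * M.adjugate j j := by
    rw [← ha', ← ha', ← hb', ← hb']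
    ring
  rw [hdiag i, zero_mul, adjugate_symm hs j i] at h1
  exact hij (mul_self_eq_zero.1 h1)

end Rank

end

section

/-! ### Heights of ideals generated by regular sequences -/

section Height

open RingTheory.Sequence

/-- A nonzerodivisor modulo `I` avoids every minimal prime of `I`, so a minimal prime of `I + (x)`
strictly contains one of these. -/
theorem height_add_one_le_height_sup_span {R : Type*} [CommRing R] {I : Ideal R} {x : R}
    (hx : IsSMulRegular (R ⧸ (I • ⊤ : Submodule R R)) x) :
    I.height + 1 ≤ (I ⊔ Ideal.span {x}).height := by
  rw [Ideal.height_eq_inf_minimalPrimes (I := I ⊔ Ideal.span {x})]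
  refine le_iInf₂ fun p hp => ?_
  have hpp : p.IsPrime := hp.1.1
  obtain ⟨q, hq, hqp⟩ := Ideal.exists_minimalPrimes_le (le_sup_left.trans hp.1.2)
  have hqq : q.IsPrime := hq.1.1
  have hxq : x ∉ q := by
    refine hx.notMem_of_mem_minimalPrimes ?_
    have : Module.annihilator R (R ⧸ (I • ⊤ : Submodule R R)) = I := by
      rw [Ideal.smul_top_eq_map, Algebra.algebraMap_self, Ideal.map_id]
      exact Ideal.annihilator_quotient
    rwa [this]
  have hlt : q < p := lt_of_le_of_ne hqp fun h =>
    hxq (h ▸ hp.1.2 (Ideal.mem_sup_right (Ideal.mem_span_singleton_self x)))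
  calc I.height + 1 ≤ q.height + 1 := by gcongr; exact hq.1.2
    _ ≤ p.height := Ideal.height_add_one_le_of_lt_of_isPrime hlt

theorem length_le_height_ofList {R : Type*} [CommRing R] {rs : List R}
    (h : IsWeaklyRegular R rs) : (rs.length : ℕ∞) ≤ (Ideal.ofList rs).height := by
  induction rs using List.reverseRecOn with
  | nil => simp
  | append_singleton rs x ih =>
    obtain ⟨h1, h2⟩ := (isWeaklyRegular_append_iff R rs [x]).1 h
    rw [Ideal.ofList_append, Ideal.ofList_singleton, List.length_append, List.length_singleton,
      Nat.cast_add, Nat.cast_one]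
    have h3 := height_add_one_le_height_sup_span ((isWeaklyRegular_singleton_iff _ x).1 h2)
    exact (add_le_add_left (ih h1) 1).trans h3

/-- At a common zero, every subfamily of a regular sequence generates an ideal whose height is at
least the number of its members. -/
theorem card_le_height_map {R : Type*} [CommRing R] [IsNoetherianRing R] {r : ℕ} {f : Fin r → R}
    (h : IsWeaklyRegular R (List.ofFn f)) (P : Ideal R) [P.IsPrime] (hf : ∀ l, f l ∈ P)
    (S : Finset (Fin r)) :
    (S.card : ℕ∞) ≤ ((Ideal.span (Set.range fun l : S => f l)).map
      (algebraMap R (Localization.AtPrime P))).height := by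
  have h1 := h.of_isLocalization (Localization.AtPrime P) P.primeCompl
  set g : Fin r → Localization.AtPrime P := fun l => algebraMap R _ (f l) with hg
  have e1 : (List.ofFn f).map (algebraMap R (Localization.AtPrime P)) =
      (List.finRange r).map g := by
    rw [List.ofFn_eq_map, List.map_map]; rfl
  rw [e1] at h1
  -- In a Noetherian local ring a regular sequence inside the maximal ideal may be permuted, so the
  -- members of `S` can be moved to the front, where they form a regular sequence by themselves.
  have hperm : ((List.finRange r).map g).Perm ((S.toList ++ Sᶜ.toList).map g) := by
    refine List.Perm.map g ((List.perm_ext_iff_of_nodup (List.nodup_finRange r) ?_).2 ?_)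
    · refine List.nodup_append.2 ⟨S.nodup_toList, Sᶜ.nodup_toList, ?_⟩
      intro a ha b hb hab
      subst hab
      simp at ha hb
      exact hb ha
    · intro a
      simp [em]
  have h3 := IsLocalRing.isWeaklyRegular_of_perm_of_subset_maximalIdeal h1 hperm (by
    intro a ha
    obtain ⟨l, -, rfl⟩ := List.mem_map.1 ha
    exact (IsLocalization.AtPrime.to_map_mem_maximal_iff _ P _).2 (hf l))
  rw [List.map_append, isWeaklyRegular_append_iff] at h3
  have h4 := length_le_height_ofList h3.1
  rw [List.length_map, Finset.length_toList] at h4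
  refine h4.trans (le_of_eq ?_)
  congr 1
  rw [Ideal.map_span, Ideal.ofList]
  congr 1
  ext a
  simp [hg]

end Height

/-! ### Homogeneity of determinants -/

section Homogeneous

variable {k : Type u} [Field k] {ι : Type}

theorem isHomogeneous_det {m : Type*} [Fintype m] [DecidableEq m]
    {M : Matrix m m (MvPolynomial ι k)} {e : m → ℕ}
    (hM : ∀ s t, (M s t).IsHomogeneous (e s)) : M.det.IsHomogeneous (∑ s, e s) := by
  rw [← Matrix.det_transpose, Matrix.det_apply]
  refine IsHomogeneous.sum _ _ _ fun σ _ => ?_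
  rw [← mem_homogeneousSubmodule, Units.smul_def]
  refine zsmul_mem ?_ _
  rw [mem_homogeneousSubmodule]
  exact IsHomogeneous.prod _ _ _ fun s _ => hM s (σ s)

end Homogeneous

namespace BlockTensor

variable {k : Type u} [Field k] {n r : ℕ} {d : Fin r → ℕ} (A : BlockTensor k n r d)

theorem isHomogeneous_blockMatrix (l : Fin r) (s t : Fin (d l)) :
    (A.blockMatrix l s t).IsHomogeneous 1 := by
  rw [blockMatrix, Matrix.of_apply]
  exact IsHomogeneous.sum _ _ _ fun j _ => by
    simpa using (isHomogeneous_C (Fin (n + 1)) (A.slice l j s t)).mul (isHomogeneous_X k j)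

theorem isSymm_blockMatrix (l : Fin r) : (A.blockMatrix l).IsSymm := by
  refine Matrix.IsSymm.ext fun s t => ?_
  simp only [blockMatrix, Matrix.of_apply]
  exact Finset.sum_congr rfl fun j _ => by rw [(A.symm l j).apply]

theorem isHomogeneous_detForm (l : Fin r) : (A.detForm l).IsHomogeneous (d l) := by
  have h := isHomogeneous_det (A.isHomogeneous_blockMatrix l)
  rwa [Finset.sum_const, Finset.card_univ, Fintype.card_fin, smul_eq_mul, mul_one] at h

theorem isHomogeneous_jacobian (l : Fin r) (j : Fin (n + 1)) :
    (jacobian A.detForm l j).IsHomogeneous (d l - 1) :=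
  (A.isHomogeneous_detForm l).pderiv

theorem isHomogeneous_jacobian_minor {a : ℕ} (e : Fin a → Fin r) (e' : Fin a → Fin (n + 1)) :
    ((jacobian A.detForm).submatrix e e').det.IsHomogeneous (∑ s, (d (e s) - 1)) :=
  isHomogeneous_det fun s t => A.isHomogeneous_jacobian (e s) (e' t)

theorem isHomogeneous_adjugate (l : Fin r) (s t : Fin (d l)) :
    ∃ e, ((A.blockMatrix l).adjugate s t).IsHomogeneous e := by
  rw [Matrix.adjugate_apply]
  -- Row `t` is replaced by a constant vector, of degree 0; the other rows consist of linear forms.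
  refine ⟨_, isHomogeneous_det (e := fun a => if a = t then 0 else 1) fun a b => ?_⟩
  by_cases h : a = t
  · subst h
    rw [Matrix.updateRow_self, if_pos rfl]
    by_cases hb : b = s
    · subst hb
      rw [Pi.single_eq_same]
      exact isHomogeneous_one _ _
    · rw [Pi.single_eq_of_ne hb]
      exact isHomogeneous_zero _ _ _
  · rw [Matrix.updateRow_ne h, if_neg h]
    exact A.isHomogeneous_blockMatrix l a b

/-- The derivative of the determinant in terms of the adjugate. -/
theorem jacobian_detForm (l : Fin r) (j : Fin (n + 1)) :
    jacobian A.detForm l j =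
      ∑ s, ∑ t, (A.blockMatrix l).adjugate s t * C (A.slice l j t s) := by
  have h : ∀ s t, pderiv j (A.blockMatrix l t s) = C (A.slice l j t s) := by
    intro s t
    simp only [blockMatrix, Matrix.of_apply, map_sum, pderiv_C_mul, pderiv_X]
    rw [Finset.sum_eq_single j (fun i _ hi => by
      rw [Pi.single_eq_of_ne hi, mul_zero]) (by simp)]
    rw [Pi.single_eq_same, mul_one]
  simp only [jacobian, Matrix.of_apply, detForm, derivation_det, h]

/-- Supplies the pivot index of a block: a principal minor that is nonzero in `coordField p`, hence
invertible after dehomogenization in a neighbourhood of `p`. -/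
theorem exists_adjugate_notMem {p : PP k (Fin (n + 1))} (hp : p ∈ A.corankLEOne) {l : Fin r}
    (hd : d l ≠ 0) (hf : A.detForm l ∈ pointIdeal p) :
    ∃ i, (A.blockMatrix l).adjugate i i ∉ pointIdeal p := by
  let φ := algebraMap (MvPolynomial (Fin (n + 1)) k) (coordField p)
  obtain ⟨i, hi⟩ := exists_adjugate_apply_self_ne_zero (M := (A.blockMatrix l).map φ) hd
    (by
      ext s t
      rw [Matrix.transpose_apply, Matrix.map_apply, Matrix.map_apply,
        (A.isSymm_blockMatrix l).apply])
    (by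
      rw [← RingHom.mapMatrix_apply, ← RingHom.map_det]
      exact (Ideal.algebraMap_residueField_eq_zero).2 hf)
    (hp l)
  refine ⟨i, fun h => hi ?_⟩
  rw [← RingHom.mapMatrix_apply, ← RingHom.map_adjugate, RingHom.mapMatrix_apply,
    Matrix.map_apply]
  exact (Ideal.algebraMap_residueField_eq_zero).2 h

theorem card_le_codimAt (hci : A.IsCompleteIntersection) {p : PP k (Fin (n + 1))}
    (hf : ∀ l, A.detForm l ∈ pointIdeal p) (S : Finset (Fin r)) :
    (S.card : ℕ∞) ≤ codimAt (fun l : S => A.detForm l) p :=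
  card_le_height_map hci.toIsWeaklyRegular _ hf S

theorem le_codimAt (hci : A.IsCompleteIntersection) {p : PP k (Fin (n + 1))}
    (hf : ∀ l, A.detForm l ∈ pointIdeal p) : (r : ℕ∞) ≤ codimAt A.detForm p := by
  have h := A.card_le_codimAt hci hf Finset.univ
  rw [Finset.card_univ, Fintype.card_fin] at h
  refine h.trans (le_of_eq ?_)
  have : Set.range (fun l : (Finset.univ : Finset (Fin r)) => A.detForm l) =
      Set.range A.detForm := by
    ext a
    simp
  rw [codimAt, codimAt, this]

theorem rankAt_jacobian_subfamily_le (p : PP k (Fin (n + 1))) (S : Finset (Fin r)) :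
    rankAt (jacobian fun l : S => A.detForm l) p ≤ rankAt (jacobian A.detForm) p := by
  obtain ⟨e, e', he⟩ := exists_minor _ (le_refl (rankAt (jacobian fun l : S => A.detForm l) p))
  exact le_rank_of_minor _ (fun i => (e i : Fin r)) e' he

/-- Away from coincident singularities, the corank of the Jacobian matrix is at most one. -/
theorem le_rankAt_jacobian_add_one (hci : A.IsCompleteIntersection) {p : PP k (Fin (n + 1))}
    (hco : ¬ A.IsCoincident p) (hp : p ∈ A.corankLEOne) (hf : ∀ l, A.detForm l ∈ pointIdeal p) :
    r ≤ rankAt (jacobian A.detForm) p + 1 := by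
  by_contra! hlt
  -- The rank is now at most `r - 2`, while any `r - 1` of the equations cut out codimension at
  -- least `r - 1`. So omitting any single equation leaves a singular point.
  have hsing : ∀ S : Finset (Fin r), r ≤ S.card + 1 →
      IsSingularPoint (fun l : S => A.detForm l) p := fun S hS =>
    ⟨fun l => hf l, lt_of_lt_of_le (by
      have := A.rankAt_jacobian_subfamily_le p S
      exact_mod_cast (show rankAt (jacobian fun l : S => A.detForm l) p < S.card by omega))
      (A.card_le_codimAt hci hf S)⟩
  -- The strict inequality on the rank forces `r ≥ 2`, so there are two equations to omit in turn.
  let a : Fin r := ⟨0, by omega⟩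
  let b : Fin r := ⟨1, by omega⟩
  have hab : a ≠ b := by simp [a, b]
  have hcard : ∀ c : Fin r, r ≤ (Finset.univ.erase c).card + 1 := fun c => by
    rw [Finset.card_erase_of_mem (Finset.mem_univ c), Finset.card_univ, Fintype.card_fin]
    omega
  have hne : ∀ c : Fin r, Finset.univ.erase c ≠ Finset.univ := fun c h =>
    Finset.notMem_erase c Finset.univ (h.symm ▸ Finset.mem_univ c)
  refine hco ⟨⟨⟨hf, lt_of_lt_of_le ?_ (A.le_codimAt hci hf)⟩, hp⟩, Finset.univ.erase a,
    Finset.univ.erase b, hne a, hne b, fun h => ?_, hsing _ (hcard a), hsing _ (hcard b)⟩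
  · exact_mod_cast (show rankAt (jacobian A.detForm) p < r by omega)
  · exact Finset.notMem_erase a Finset.univ
      (h ▸ Finset.mem_erase.2 ⟨hab, Finset.mem_univ a⟩)

/-- With `r + 1` blocks, corank at most one is a nonvanishing minor of size `r`. The omitted row
will be the block whose pivot coordinate is normalized to 1. -/
theorem exists_jacobian_minor_notMem {n r : ℕ} {d : Fin (r + 1) → ℕ}
    (A : BlockTensor k n (r + 1) d) (hci : A.IsCompleteIntersection) {p : PP k (Fin (n + 1))}
    (hco : ¬ A.IsCoincident p) (hp : p ∈ A.corankLEOne) (hf : ∀ l, A.detForm l ∈ pointIdeal p) :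
    ∃ (i : Fin (r + 1)) (e : Fin r → Fin (n + 1)),
      ((jacobian A.detForm).submatrix i.succAbove e).det ∉ pointIdeal p := by
  obtain ⟨i, e, he⟩ := exists_minor_succAbove
    (Nat.le_of_succ_le_succ (A.le_rankAt_jacobian_add_one hci hco hp hf))
  refine ⟨i, e, fun h => he ?_⟩
  have h1 := RingHom.map_det (algebraMap _ (coordField p))
    ((jacobian A.detForm).submatrix i.succAbove e)
  rw [(Ideal.algebraMap_residueField_eq_zero).2 h] at h1
  exact h1.symm

end BlockTensor

end

section

/-! ### Adjoining square roots -/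

section SquareRoots

/-- Adjoining square roots of `m` elements of a ring universally yields a free algebra of rank
`2 ^ m`. -/
theorem exists_adjoin_sqrt {R : Type u} [CommRing R] {m : ℕ} (b : Fin m → R) :
    ∃ (B : Type u) (_ : CommRing B) (_ : Algebra R B) (c : Fin m → B),
      Nonempty (Module.Basis (Fin (2 ^ m)) R B) ∧ (∀ l, c l ^ 2 = algebraMap R B (b l)) ∧
      (∀ (S : Type u) [CommRing S] (ψ ψ' : B →+* S),
        ψ.comp (algebraMap R B) = ψ'.comp (algebraMap R B) → (∀ l, ψ (c l) = ψ' (c l)) → ψ = ψ') ∧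
      ∀ (S : Type u) [CommRing S] (φ : R →+* S) (c' : Fin m → S), (∀ l, c' l ^ 2 = φ (b l)) →
        ∃ ψ : B →+* S, ψ.comp (algebraMap R B) = φ ∧ ∀ l, ψ (c l) = c' l := by
  induction m with
  | zero =>
    refine ⟨R, inferInstance, inferInstance, Fin.elim0, ⟨Module.Basis.singleton (Fin 1) R⟩,
      fun l => l.elim0, fun S _ ψ ψ' h _ => ?_, fun S _ φ c' _ => ⟨φ, ?_, fun l => l.elim0⟩⟩
    · simpa using h
    · simp
  | succ m ih =>
    obtain ⟨B, _, _, c, ⟨β⟩, hc, huniq, hex⟩ := ih (fun l => b l.castSucc)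
    -- This polynomial is monic, so adjoining its root is free of rank two for every `b`, units or
    -- not.
    let f : Polynomial B := Polynomial.X ^ 2 - Polynomial.C (algebraMap R B (b (Fin.last m)))
    have hf : f.Monic := Polynomial.monic_X_pow_sub_C _ two_ne_zero
    have hroot : (AdjoinRoot.root f) ^ 2 =
        AdjoinRoot.of f (algebraMap R B (b (Fin.last m))) := by
      have := AdjoinRoot.eval₂_root f
      simpa [f, sub_eq_zero] using this
    have hbasis : Nonempty (Module.Basis (Fin 2) B (AdjoinRoot f)) := by
      -- The degree of `f` is two only over a nontrivial ring; over the zero ring every module is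
      -- zero and a basis exists trivially.
      cases subsingleton_or_nontrivial B with
      | inl h =>
        have : Subsingleton (AdjoinRoot f) := Module.subsingleton B _
        exact ⟨⟨0⟩⟩
      | inr h =>
        refine ⟨(AdjoinRoot.powerBasis' hf).basis.reindex (finCongr ?_)⟩
        rw [AdjoinRoot.powerBasis'_dim]
        exact Polynomial.natDegree_X_pow_sub_C
    obtain ⟨β'⟩ := hbasis
    have hfac : ∀ a : R, algebraMap R (AdjoinRoot f) a = AdjoinRoot.of f (algebraMap R B a) :=
      fun a => IsScalarTower.algebraMap_apply R B (AdjoinRoot f) a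
    refine ⟨AdjoinRoot f, inferInstance, inferInstance,
      Fin.snoc (fun l => AdjoinRoot.of f (c l)) (AdjoinRoot.root f), ⟨?_⟩, fun l => ?_,
      fun S _ ψ ψ' h h' => ?_, fun S _ φ c' hc' => ?_⟩
    · exact (β.smulTower β').reindex (Fintype.equivOfCardEq (by simp [pow_succ]))
    · rw [hfac]
      refine Fin.lastCases ?_ (fun l => ?_) l
      · rw [Fin.snoc_last, hroot]
      · rw [Fin.snoc_castSucc, ← map_pow, hc]
    · refine AdjoinRoot.ringHom_ext (huniq S _ _ ?_ fun l => ?_) ?_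
      · ext a
        simpa [hfac] using RingHom.congr_fun h a
      · simpa using h' l.castSucc
      · simpa using h' (Fin.last m)
    · obtain ⟨ψ, hψ, hψc⟩ := hex S φ (fun l => c' l.castSucc) fun l => hc' _
      have h0 : f.eval₂ ψ (c' (Fin.last m)) = 0 := by
        have := RingHom.congr_fun hψ (b (Fin.last m))
        simp only [RingHom.comp_apply] at this
        simp [f, this, hc']
      refine ⟨AdjoinRoot.lift ψ (c' (Fin.last m)) h0, ?_, fun l => ?_⟩
      · ext a
        rw [RingHom.comp_apply, hfac, AdjoinRoot.lift_of, ← hψ, RingHom.comp_apply]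
      · refine Fin.lastCases ?_ (fun l => ?_) l
        · rw [Fin.snoc_last, AdjoinRoot.lift_root]
        · rw [Fin.snoc_castSucc, AdjoinRoot.lift_of, hψc]

/-- Adjoining square roots of `m` functions on a scheme universally yields a finite flat cover of
rank `2 ^ m`. -/
theorem exists_sqrt_cover {P : Scheme.{u}} {m : ℕ} (b : Fin m → Γ(P, ⊤)) :
    ∃ (Q : Scheme.{u}) (q : Q ⟶ P) (c : Fin m → Γ(Q, ⊤)),
      (IsFinite q ∧ Flat q ∧ ∀ z, q.finrank z = 2 ^ m) ∧
      (∀ l, c l ^ 2 = q.appTop.hom (b l)) ∧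
      (∀ (T : Scheme.{u}) (g g' : T ⟶ Q), g ≫ q = g' ≫ q →
        (∀ l, g.appTop.hom (c l) = g'.appTop.hom (c l)) → g = g') ∧
      ∀ (T : Scheme.{u}) (t : T ⟶ P) (c' : Fin m → Γ(T, ⊤)),
        (∀ l, c' l ^ 2 = t.appTop.hom (b l)) →
        ∃ g : T ⟶ Q, g ≫ q = t ∧ ∀ l, g.appTop.hom (c l) = c' l := by
  obtain ⟨B, _, _, c, ⟨β⟩, hc, huniq, hex⟩ := exists_adjoin_sqrt b
  have : Module.Free Γ(P, ⊤) B := .of_basis β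
  have : Module.Finite Γ(P, ⊤) B := .of_basis β
  let φ : Γ(P, ⊤) ⟶ CommRingCat.of B := CommRingCat.ofHom (algebraMap Γ(P, ⊤) B)
  have hfin : IsFinite (Spec.map φ) := (IsFinite.SpecMap_iff _).2
    ((RingHom.finite_algebraMap).2 inferInstance)
  have hflat : Flat (Spec.map φ) := (Flat.SpecMap_iff).2
    ((RingHom.flat_algebraMap_iff).2 inferInstance)
  -- `P` need not be affine: the cover of `Spec Γ(P, ⊤)` is pulled back to `P`, which preserves
  -- finiteness, flatness and rank.
  let q := pullback.snd (Spec.map φ) P.toSpecΓ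
  let w := pullback.fst (Spec.map φ) P.toSpecΓ
  have hcond : w ≫ Spec.map φ = q ≫ P.toSpecΓ := pullback.condition
  have hφ : φ ≫ (Scheme.ΓSpecIso (.of B)).inv ≫ w.appTop = q.appTop := by
    have h1 := congrArg Scheme.Hom.appTop hcond
    rw [Scheme.Hom.comp_appTop, Scheme.Hom.comp_appTop, Scheme.toSpecΓ_appTop] at h1
    rw [← Category.assoc, Scheme.ΓSpecIso_inv_naturality, Category.assoc, h1,
      Iso.inv_hom_id_assoc]
  refine ⟨pullback (Spec.map φ) P.toSpecΓ, q,
    fun l => ((Scheme.ΓSpecIso (.of B)).inv ≫ w.appTop).hom (c l), ⟨inferInstance, inferInstance,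
    fun z => ?_⟩, fun l => ?_, fun T g g' h h' => ?_, fun T t c' hc' => ?_⟩
  · rw [Scheme.Hom.finrank_pullback_snd]
    refine (Scheme.Hom.finrank_SpecMap_algebraMap Γ(P, ⊤) B _).trans ?_
    -- A basis determines the rank only over a nontrivial ring; the point `z` guarantees this.
    have hn : Nontrivial Γ(P, ⊤) := by
      by_contra h
      rw [not_nontrivial_iff_subsingleton] at h
      exact (PrimeSpectrum.isEmpty_iff_subsingleton.2 h).false (P.toSpecΓ z)
    refine (congrFun Module.rankAtStalk_eq_finrank_of_free (P.toSpecΓ z)).trans ?_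
    exact (Module.finrank_eq_card_basis β).trans (Fintype.card_fin _)
  · rw [← map_pow, hc, ← hφ]
    rfl
  · refine pullback.hom_ext (ext_of_isAffine ?_) h
    rw [← cancel_epi (Scheme.ΓSpecIso (.of B)).inv]
    refine CommRingCat.hom_ext (huniq _ _ _ ?_ fun l => ?_)
    · have h1 := congrArg Scheme.Hom.appTop h
      rw [Scheme.Hom.comp_appTop, Scheme.Hom.comp_appTop, ← hφ] at h1
      have h2 : ∀ g : T ⟶ pullback (Spec.map φ) P.toSpecΓ,
          φ ≫ (Scheme.ΓSpecIso (.of B)).inv ≫ (g ≫ w).appTop =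
            (φ ≫ (Scheme.ΓSpecIso (.of B)).inv ≫ w.appTop) ≫ g.appTop := fun g => by
        rw [Scheme.Hom.comp_appTop]
        simp only [Category.assoc]
      exact congrArg CommRingCat.Hom.hom ((h2 g).trans (h1.trans (h2 g').symm))
    · have h3 := h' l
      have h2 : ∀ g : T ⟶ pullback (Spec.map φ) P.toSpecΓ,
          (Scheme.ΓSpecIso (.of B)).inv ≫ (g ≫ w).appTop =
            ((Scheme.ΓSpecIso (.of B)).inv ≫ w.appTop) ≫ g.appTop := fun g => by
        rw [Scheme.Hom.comp_appTop]
        simp only [Category.assoc]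
      exact (RingHom.congr_fun (congrArg CommRingCat.Hom.hom (h2 g)) _).trans
        (h3.trans (RingHom.congr_fun (congrArg CommRingCat.Hom.hom (h2 g')) _).symm)
  · obtain ⟨ψ, hψ, hψc⟩ := hex Γ(T, ⊤) t.appTop.hom c' hc'
    have hψ' : φ ≫ CommRingCat.ofHom ψ = t.appTop := CommRingCat.hom_ext hψ
    let z : T ⟶ Spec (.of B) := T.toSpecΓ ≫ Spec.map (CommRingCat.ofHom ψ)
    have hz : z ≫ Spec.map φ = t ≫ P.toSpecΓ := by
      rw [Category.assoc, ← Spec.map_comp, hψ', Scheme.toSpecΓ_naturality]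
    refine ⟨pullback.lift z t hz, pullback.lift_snd _ _ _, fun l => ?_⟩
    have h1 : ((Scheme.ΓSpecIso (.of B)).inv ≫ w.appTop) ≫ (pullback.lift z t hz).appTop =
        CommRingCat.ofHom ψ := by
      rw [Category.assoc, ← Scheme.Hom.comp_appTop, pullback.lift_fst, Scheme.Hom.comp_appTop,
        Scheme.toSpecΓ_appTop, Scheme.ΓSpecIso_naturality, Iso.inv_hom_id_assoc]
    exact (RingHom.congr_fun (congrArg CommRingCat.Hom.hom h1) (c l)).trans (hψc l)

end SquareRoots

end

section

/-! ### The equations of the incidence scheme over a ring -/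

namespace BlockTensor

section Equations

variable {k : Type u} [Field k] {n r : ℕ} {d : Fin r → ℕ} (A : BlockTensor k n r d)
  {R : Type*} [CommRing R]

/-- The equations `A(x, y, ·) = 0` and `A(·, y, y) = 0`, where the coordinates of `x` are given by
a homomorphism from the polynomial ring. -/
structure IsIncident (ev : MvPolynomial (Fin (n + 1)) k →+* R) (y : Idx d → R) : Prop where
  bilinear : ∀ t, ∑ s, ev (A.entry s t) * y s = 0
  quadric : ∀ j, ∑ s, ∑ t, ev (C (A.fullSlice j s t)) * y s * y t = 0

theorem fullSlice_self (j : Fin (n + 1)) (l : Fin r) (s t : Fin (d l)) :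
    A.fullSlice j ⟨l, s⟩ ⟨l, t⟩ = A.slice l j s t := by
  simp [fullSlice, Matrix.blockDiagonal'_apply]

theorem fullSlice_of_ne (j : Fin (n + 1)) {l l' : Fin r} (h : l ≠ l') (s : Fin (d l))
    (t : Fin (d l')) : A.fullSlice j ⟨l, s⟩ ⟨l', t⟩ = 0 := by
  simp [fullSlice, Matrix.blockDiagonal'_apply, h]

theorem entry_self (l : Fin r) (s t : Fin (d l)) :
    A.entry ⟨l, s⟩ ⟨l, t⟩ = A.blockMatrix l s t := by
  simp only [entry, fullSlice_self, blockMatrix, Matrix.of_apply]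

theorem entry_of_ne {l l' : Fin r} (h : l ≠ l') (s : Fin (d l)) (t : Fin (d l')) :
    A.entry ⟨l, s⟩ ⟨l', t⟩ = 0 := by
  simp only [entry, A.fullSlice_of_ne _ h, map_zero, zero_mul, Finset.sum_const_zero]

variable (ev : MvPolynomial (Fin (n + 1)) k →+* R) (y : Idx d → R)

/-- Entries between different blocks vanish, so the bilinear equations split into one kernel
condition per block; symmetry turns the sum over the first index into `mulVec`. -/
theorem sum_entry_mul (l : Fin r) (t : Fin (d l)) :
    ∑ s, ev (A.entry s ⟨l, t⟩) * y s =
      (((A.blockMatrix l).map ev).mulVec fun s => y ⟨l, s⟩) t := by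
  rw [Fintype.sum_sigma, Finset.sum_eq_single l]
  · refine Finset.sum_congr rfl fun s _ => ?_
    rw [entry_self, ← (A.isSymm_blockMatrix l).apply]
    rfl
  · intro l' _ h
    exact Finset.sum_eq_zero fun s _ => by rw [A.entry_of_ne h, map_zero, zero_mul]
  · simp

theorem sum_fullSlice_mul (j : Fin (n + 1)) :
    ∑ s, ∑ t, ev (C (A.fullSlice j s t)) * y s * y t =
      ∑ l, ∑ s, ∑ t, ev (C (A.slice l j s t)) * y ⟨l, s⟩ * y ⟨l, t⟩ := by
  rw [Fintype.sum_sigma]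
  refine Finset.sum_congr rfl fun l _ => Finset.sum_congr rfl fun s _ => ?_
  rw [Fintype.sum_sigma, Finset.sum_eq_single l]
  · exact Finset.sum_congr rfl fun t _ => by rw [fullSlice_self]
  · intro l' _ h
    exact Finset.sum_eq_zero fun t _ => by
      rw [A.fullSlice_of_ne j h.symm, map_zero, map_zero, zero_mul, zero_mul]
  · simp

theorem map_detForm (l : Fin r) : ev (A.detForm l) = ((A.blockMatrix l).map ev).det :=
  RingHom.map_det ev _

theorem map_adjugate (l : Fin r) (s t : Fin (d l)) :
    ev ((A.blockMatrix l).adjugate s t) = ((A.blockMatrix l).map ev).adjugate s t := by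
  have h := RingHom.map_adjugate ev (A.blockMatrix l)
  exact congrFun (congrFun h s) t

variable {ev y}

theorem map_adjugate_mul (hdet : ∀ l, ev (A.detForm l) = 0) {l : Fin r} {i : Fin (d l)}
    (ha : IsUnit (ev ((A.blockMatrix l).adjugate i i))) (s t : Fin (d l)) :
    ev ((A.blockMatrix l).adjugate i i) * ev ((A.blockMatrix l).adjugate s t) =
      ev ((A.blockMatrix l).adjugate s i) * ev ((A.blockMatrix l).adjugate t i) := by
  have hs : ((A.blockMatrix l).map ev).IsSymm := Matrix.IsSymm.ext fun s t => by
    rw [Matrix.map_apply, Matrix.map_apply, (A.isSymm_blockMatrix l).apply]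
  rw [map_adjugate] at ha
  simp only [map_adjugate]
  exact adjugate_mul_adjugate (by rw [← map_detForm, hdet]) hs ha s t

/-- The part of a solution in one block is determined by a single coordinate. -/
theorem IsIncident.mul_eq (h : A.IsIncident ev y) (hdet : ∀ l, ev (A.detForm l) = 0) {l : Fin r}
    {i : Fin (d l)} (ha : IsUnit (ev ((A.blockMatrix l).adjugate i i))) (s : Fin (d l)) :
    ev ((A.blockMatrix l).adjugate i i) * y ⟨l, s⟩ =
      ev ((A.blockMatrix l).adjugate s i) * y ⟨l, i⟩ := by
  rw [map_adjugate] at ha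
  rw [map_adjugate, map_adjugate]
  refine eq_smul_adjugate_of_mulVec_eq_zero (by rw [← map_detForm, hdet]) ha
    (y := fun s => y ⟨l, s⟩) ?_ s
  funext t
  rw [← sum_entry_mul]
  exact h.bilinear ⟨l, t⟩

/-- The value of a quadric on a vector whose blocks are in the kernels. -/
theorem sum_slice_mul (hdet : ∀ l, ev (A.detForm l) = 0) {l : Fin r} {i : Fin (d l)} {a : R}
    (ha : a * ev ((A.blockMatrix l).adjugate i i) = 1)
    (hy : ∀ s, ev ((A.blockMatrix l).adjugate i i) * y ⟨l, s⟩ =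
      ev ((A.blockMatrix l).adjugate s i) * y ⟨l, i⟩) (j : Fin (n + 1)) :
    ∑ s, ∑ t, ev (C (A.slice l j s t)) * y ⟨l, s⟩ * y ⟨l, t⟩ =
      a * y ⟨l, i⟩ ^ 2 * ev (jacobian A.detForm l j) := by
  have hu : IsUnit (ev ((A.blockMatrix l).adjugate i i)) := IsUnit.of_mul_eq_one_right _ ha
  rw [jacobian_detForm]
  simp only [map_sum, Finset.mul_sum, map_mul]
  refine Finset.sum_congr rfl fun s _ => Finset.sum_congr rfl fun t _ => ?_
  -- Write `v` for column `i` of the adjugate. Then `y_s = a v_s c`, while the adjugate has entries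
  -- `a v_s v_t` because it has rank one. Products of coordinates therefore become adjugate entries,
  -- which is what Jacobi's formula sums.
  have e1 := A.map_adjugate_mul hdet hu s t
  rw [(A.symm l j).apply]
  set α := ev ((A.blockMatrix l).adjugate i i)
  set c := y ⟨l, i⟩
  have e2 : ∀ s, y ⟨l, s⟩ = a * (ev ((A.blockMatrix l).adjugate s i) * c) := fun s => by
    rw [← hy s, ← mul_assoc, ha, one_mul]
  have e3 : ev ((A.blockMatrix l).adjugate s t) = a * (ev ((A.blockMatrix l).adjugate s i) *
      ev ((A.blockMatrix l).adjugate t i)) := by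
    rw [← e1, ← mul_assoc, ha, one_mul]
  rw [e2 s, e2 t, e3]
  ring

variable {i : ∀ l, Fin (d l)} {a : Fin r → R}

/-- On the incidence scheme the rows of the Jacobian matrix are linearly dependent. -/
theorem IsIncident.sum_mul_jacobian (h : A.IsIncident ev y) (hdet : ∀ l, ev (A.detForm l) = 0)
    (ha : ∀ l, a l * ev ((A.blockMatrix l).adjugate (i l) (i l)) = 1) (j : Fin (n + 1)) :
    ∑ l, (a l * y ⟨l, i l⟩ ^ 2) * ((jacobian A.detForm).map ev) l j = 0 := by
  rw [← h.quadric j, sum_fullSlice_mul]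
  refine Finset.sum_congr rfl fun l _ => ?_
  rw [A.sum_slice_mul hdet (ha l)
    (h.mul_eq A hdet (IsUnit.of_mul_eq_one_right _ (ha l))) j, Matrix.map_apply]

theorem map_jacobian_minor {m : ℕ} (e : Fin m → Fin r) (e' : Fin m → Fin (n + 1)) :
    ev ((jacobian A.detForm).submatrix e e').det =
      (((jacobian A.detForm).map ev).submatrix e e').det :=
  RingHom.map_det ev _

/-- The maximal minors of the Jacobian matrix vanish on the incidence scheme. -/
theorem IsIncident.jacobian_minor_eq_zero (h : A.IsIncident ev y)
    (hdet : ∀ l, ev (A.detForm l) = 0)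
    (ha : ∀ l, IsUnit (ev ((A.blockMatrix l).adjugate (i l) (i l)))) {s : Idx d} (hs : y s = 1)
    (e : Fin r → Fin (n + 1)) : ev ((jacobian A.detForm).submatrix id e).det = 0 := by
  choose a ha' using fun l => (ha l).exists_left_inv
  obtain ⟨l, s⟩ := s
  have h1 := h.mul_eq A hdet (ha l) s
  rw [hs, mul_one] at h1
  have h2 : IsUnit (y ⟨l, i l⟩) := isUnit_of_mul_isUnit_right (h1 ▸ ha l)
  rw [map_jacobian_minor]
  exact det_eq_zero_of_vecMul_eq_zero (h.sum_mul_jacobian A hdet ha')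
    ((IsUnit.of_mul_eq_one _ (ha' l)).mul (h2.pow 2)) e

end Equations

/-! ### Solving the incidence equations by square roots. -/

section Parametrization

variable {k : Type u} [Field k] {n r : ℕ} {d : Fin (r + 1) → ℕ} (A : BlockTensor k n (r + 1) d)
  {R : Type*} [CommRing R] {ev : MvPolynomial (Fin (n + 1)) k →+* R} {y : Idx d → R}
  {i : ∀ l, Fin (d l)} {a : Fin (r + 1) → R} {o : Fin (r + 1)} {e : Fin r → Fin (n + 1)}

/-- The signed minors of the Jacobian matrix, as polynomials. -/
def jacobianMinor (e : Fin r → Fin (n + 1)) (l : Fin (r + 1)) : MvPolynomial (Fin (n + 1)) k :=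
  minorVector (jacobian A.detForm) e l

theorem map_jacobianMinor (e : Fin r → Fin (n + 1)) (l : Fin (r + 1)) :
    ev (A.jacobianMinor e l) = minorVector ((jacobian A.detForm).map ev) e l := by
  rw [jacobianMinor, minorVector, minorVector, map_mul, map_jacobian_minor, map_pow, map_neg,
    map_one]

/-- The weights `a l * y ⟨l, i l⟩ ^ 2` lie in the left kernel of the Jacobian matrix, which is
spanned by the vector of minors because one of them is a unit. -/
theorem IsIncident.minor_mul (h : A.IsIncident ev y) (hdet : ∀ l, ev (A.detForm l) = 0)
    (hJ : ∀ e : Fin (r + 1) → Fin (n + 1), ev ((jacobian A.detForm).submatrix id e).det = 0)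
    (ha : ∀ l, a l * ev ((A.blockMatrix l).adjugate (i l) (i l)) = 1)
    (hm : IsUnit (ev (A.jacobianMinor e o))) (l : Fin (r + 1)) :
    ev (A.jacobianMinor e o) * (a l * y ⟨l, i l⟩ ^ 2) =
      ev (A.jacobianMinor e l) * (a o * y ⟨o, i o⟩ ^ 2) := by
  rw [map_jacobianMinor] at hm
  rw [map_jacobianMinor, map_jacobianMinor]
  exact mul_minorVector_of_vecMul_eq_zero (fun e => by rw [← map_jacobian_minor, hJ]) hm
    (w := fun l => a l * y ⟨l, i l⟩ ^ 2) (h.sum_mul_jacobian A hdet ha) l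

/-- This permits the normalization of the pivot of block `o`. A unit coordinate in block `l` makes
the pivot of that block a unit, and the relation `minor_mul` between the two weights passes
invertibility on to block `o`. -/
theorem IsIncident.isUnit (h : A.IsIncident ev y) (hdet : ∀ l, ev (A.detForm l) = 0)
    (hJ : ∀ e : Fin (r + 1) → Fin (n + 1), ev ((jacobian A.detForm).submatrix id e).det = 0)
    (ha : ∀ l, IsUnit (ev ((A.blockMatrix l).adjugate (i l) (i l))))
    (hm : IsUnit (ev (A.jacobianMinor e o))) {s : Idx d} (hs : y s = 1) :
    IsUnit (y ⟨o, i o⟩) := by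
  choose a ha' using fun l => (ha l).exists_left_inv
  obtain ⟨l, s⟩ := s
  have h1 := h.mul_eq A hdet (ha l) s
  rw [hs, mul_one] at h1
  have h2 : IsUnit (y ⟨l, i l⟩) := isUnit_of_mul_isUnit_right (h1 ▸ ha l)
  have h3 := h.minor_mul A hdet hJ ha' hm l
  have h4 := hm.mul ((IsUnit.of_mul_eq_one _ (ha' l)).mul (h2.pow 2))
  rw [h3] at h4
  exact isUnit_pow_iff two_ne_zero |>.1 (isUnit_of_mul_isUnit_right (isUnit_of_mul_isUnit_right h4))

/-- A normalized solution is given by square roots. -/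
theorem IsIncident.sq_eq (h : A.IsIncident ev y) (hdet : ∀ l, ev (A.detForm l) = 0)
    (hJ : ∀ e : Fin (r + 1) → Fin (n + 1), ev ((jacobian A.detForm).submatrix id e).det = 0)
    (ha : ∀ l, a l * ev ((A.blockMatrix l).adjugate (i l) (i l)) = 1) {m : R}
    (hm : m * ev (A.jacobianMinor e o) = 1) (ho : y ⟨o, i o⟩ = 1) (l : Fin (r + 1)) :
    y ⟨l, i l⟩ ^ 2 = ev ((A.blockMatrix l).adjugate (i l) (i l)) * a o *
      (ev (A.jacobianMinor e l) * m) := by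
  have h1 := h.minor_mul A hdet hJ ha (IsUnit.of_mul_eq_one_right _ hm) l
  rw [ho] at h1
  have h2 := congrArg (fun z => m * ev ((A.blockMatrix l).adjugate (i l) (i l)) * z) h1
  linear_combination h2 - y ⟨l, i l⟩ ^ 2 * (ha l) * (m * ev (A.jacobianMinor e o))
    - y ⟨l, i l⟩ ^ 2 * hm

/-- Square roots give a solution. -/
theorem isIncident_of_sq_eq (hdet : ∀ l, ev (A.detForm l) = 0)
    (hJ : ∀ e : Fin (r + 1) → Fin (n + 1), ev ((jacobian A.detForm).submatrix id e).det = 0)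
    (ha : ∀ l, a l * ev ((A.blockMatrix l).adjugate (i l) (i l)) = 1) {m : R}
    {c : Fin (r + 1) → R}
    (hc : ∀ l, c l ^ 2 = ev ((A.blockMatrix l).adjugate (i l) (i l)) * a o *
      (ev (A.jacobianMinor e l) * m)) :
    A.IsIncident ev fun s => a s.1 * ev ((A.blockMatrix s.1).adjugate s.2 (i s.1)) * c s.1 := by
  refine ⟨fun ⟨l, t⟩ => ?_, fun j => ?_⟩
  · rw [sum_entry_mul]
    have h1 : (fun s : Fin (d l) => a l * ev ((A.blockMatrix l).adjugate s (i l)) * c l) =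
        (a l * c l) • fun s => ((A.blockMatrix l).map ev).adjugate s (i l) := by
      funext s
      rw [map_adjugate, Pi.smul_apply, smul_eq_mul]
      ring
    refine (congrArg (fun v => ((A.blockMatrix l).map ev).mulVec v t) h1).trans ?_
    rw [Matrix.mulVec_smul, mulVec_adjugate_col (by rw [← map_detForm, hdet]), smul_zero,
      Pi.zero_apply]
  · rw [sum_fullSlice_mul]
    -- Up to the common factor `a o * m`, block `l` contributes the `l`-th signed minor times the
    -- `(l, j)` entry of the Jacobian matrix; these add up to a maximal minor, which vanishes.
    have h1 : ∀ l, ∑ s, ∑ t, ev (C (A.slice l j s t)) *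
        (a l * ev ((A.blockMatrix l).adjugate s (i l)) * c l) *
        (a l * ev ((A.blockMatrix l).adjugate t (i l)) * c l) =
        (a o * m) * (minorVector ((jacobian A.detForm).map ev) e l *
          ((jacobian A.detForm).map ev) l j) := by
      intro l
      have h2 := A.sum_slice_mul
        (y := fun s => a s.1 * ev ((A.blockMatrix s.1).adjugate s.2 (i s.1)) * c s.1) hdet (ha l)
        (fun s => by ring) j
      refine h2.trans ?_
      rw [← map_jacobianMinor, Matrix.map_apply]
      dsimp only
      rw [ha, one_mul, hc]
      linear_combination (a o * m * ev (A.jacobianMinor e l) * ev (jacobian A.detForm l j)) * ha l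
    refine (Finset.sum_congr rfl fun l _ => h1 l).trans ?_
    rw [← Finset.mul_sum, minorVector_vecMul fun e => by rw [← map_jacobian_minor, hJ], mul_zero]

end Parametrization

end BlockTensor

end

section

/-! ### Morphisms to closed subschemes -/

/-- By the adjunction of `comap` and `map`, a `T`-point lands in the preimage of a closed subscheme
iff its image lands in the subscheme. -/
theorem comap_le_ker_iff {X Y T : Scheme.{u}} (I : Y.IdealSheafData) (f : X ⟶ Y) (g : T ⟶ X) :
    I.comap f ≤ g.ker ↔ I ≤ (g ≫ f).ker := by
  rw [← Scheme.IdealSheafData.le_map_iff_comap_le, Scheme.IdealSheafData.map_ker]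

theorem exists_lift_subscheme {X T : Scheme.{u}} {I : X.IdealSheafData} {g : T ⟶ X}
    (h : I ≤ g.ker) : ∃ g' : T ⟶ I.subscheme, g' ≫ I.subschemeι = g :=
  ⟨g.toImage ≫ Scheme.IdealSheafData.inclusion h, by
    rw [Category.assoc, Scheme.IdealSheafData.inclusion_subschemeι]
    exact g.toImage_imageι⟩

theorem le_ker_comp_subschemeι {X T : Scheme.{u}} (I : X.IdealSheafData) (g : T ⟶ I.subscheme) :
    I ≤ (g ≫ I.subschemeι).ker := by
  conv_lhs => rw [← I.ker_subschemeι]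
  exact Scheme.Hom.le_ker_comp _ _

theorem section_eq_zero_of_locally {T : Scheme.{u}} {U : T.Opens} {s : Γ(T, U)}
    (h : ∀ t ∈ U, ∃ (V : T.Opens) (hV : V ≤ U), t ∈ V ∧
      (T.presheaf.map (homOfLE hV).op).hom s = 0) : s = 0 := by
  refine TopCat.Presheaf.section_ext T.sheaf _ _ _ fun t ht => ?_
  obtain ⟨V, hV, htV, h0⟩ := h t ht
  have h1 := germ_res_hom hV t htV s
  rw [h0, map_zero] at h1
  exact h1.symm.trans (map_zero (T.presheaf.germ U t ht).hom).symm

variable {k : Type u} [Field k] {ι : Type} {T : Scheme.{u}}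

theorem isCompatible_projIdeal (G : Set (MvPolynomial ι k)) :
    IsCompatible (fun i : ι => chart k i)
      (fun i => {s | ∃ (e : ℕ) (F : MvPolynomial ι k) (hF : F.IsHomogeneous e),
        F ∈ G ∧ s = dehom i F hF}) := by
  rintro i i' p hp hp' s ⟨e, F, hF, hG, rfl⟩
  refine (congrArg (· ∈ _) (germ_dehom_change p i i' hp hp' hF)).mpr ?_
  exact Ideal.mul_mem_right _ _ (Ideal.subset_span ⟨_, ⟨e, F, hF, hG, rfl⟩, rfl⟩)

theorem projIdeal_le_ker_iff (G : Set (MvPolynomial ι k)) (y : T ⟶ PP k ι) :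
    projIdeal G ≤ y.ker ↔ ∀ (i : ι) (e : ℕ) (F : MvPolynomial ι k), F ∈ G → F.IsHomogeneous e →
      evalAt y i (y ⁻¹ᵁ chart k i) le_rfl F = 0 := by
  refine ((isCompatible_projIdeal G).idealSpan_le_ker_iff iSup_chart_eq_top y).trans ?_
  constructor
  · intro h i e F hG hF
    rw [← app_dehom y i hF]
    exact h i _ ⟨e, F, hF, hG, rfl⟩
  · rintro h i _ ⟨e, F, hF, hG, rfl⟩
    rw [app_dehom]
    exact h i e F hG hF

theorem evalAt_eq_zero_of_le_ker {G : Set (MvPolynomial ι k)} {y : T ⟶ PP k ι}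
    (h : projIdeal G ≤ y.ker) {F : MvPolynomial ι k} (hG : F ∈ G) {e : ℕ} (hF : F.IsHomogeneous e)
    (i : ι) (U : T.Opens) (hU : U ≤ y ⁻¹ᵁ chart k i) : evalAt y i U hU F = 0 := by
  rw [← evalAt_res y i le_rfl hU, (projIdeal_le_ker_iff G y).1 h i e F hG hF, map_zero]

theorem projIdeal_le_ker_of_chart {G : Set (MvPolynomial ι k)} {y : T ⟶ PP k ι} {i : ι}
    (hi : ⊤ ≤ y ⁻¹ᵁ chart k i) (h : ∀ F ∈ G, evalAt y i ⊤ hi F = 0) :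
    projIdeal G ≤ y.ker := by
  refine (projIdeal_le_ker_iff G y).2 fun i' e F hG hF => ?_
  rw [evalAt_change y i' i _ le_rfl (le_top.trans hi) hF,
    ← evalAt_res y i hi le_top, h F hG, map_zero, zero_mul]

theorem isUnit_evalAt (y : T ⟶ PP k ι) (i : ι) (U : T.Opens) (hU : U ≤ y ⁻¹ᵁ chart k i)
    {e : ℕ} {F : MvPolynomial ι k} (hF : F.IsHomogeneous e)
    (h : ∀ t ∈ U, F ∉ pointIdeal (y t)) : IsUnit (evalAt y i U hU F) := by
  refine T.toRingedSpace.isUnit_of_isUnit_germ U _ fun t ht => ?_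
  exact (Scheme.mem_basicOpen _ _ _ ht).1 ((basicOpen_evalAt y i U hU hF ht).2 (h t ht))

theorem mem_chart_of_isUnit (y : T ⟶ PP k ι) (i j : ι) (U : T.Opens) (hU : U ≤ y ⁻¹ᵁ chart k i)
    (h : IsUnit (evalAt y i U hU (X j))) : U ≤ y ⁻¹ᵁ chart k j := by
  intro t ht
  have h1 : t ∈ T.basicOpen (evalAt y i U hU (X j)) := by
    rw [Scheme.basicOpen_of_isUnit _ h]
    exact ht
  exact (basicOpen_evalAt y i U hU (isHomogeneous_X k j) ht).1 h1

/-! ### The bilinear equations in pairs of charts. -/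

namespace BlockTensor

variable {n r : ℕ} {d : Fin r → ℕ} (A : BlockTensor k n r d)

/-- The `t`-th coordinate of the covector `A(x, y, ·)` with respect to charts. -/
def bilinearValue (x : T ⟶ PP k (Fin (n + 1))) (y : T ⟶ PP k (Idx d)) (i : Fin (n + 1))
    (j : Idx d) (U : T.Opens) (hx : U ≤ x ⁻¹ᵁ chart k i) (hy : U ≤ y ⁻¹ᵁ chart k j) (t : Idx d) :
    Γ(T, U) :=
  ∑ s, evalAt x i U hx (A.entry s t) * evalAt y j U hy (X s)

theorem bilinearValue_res (x : T ⟶ PP k (Fin (n + 1))) (y : T ⟶ PP k (Idx d)) (i : Fin (n + 1))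
    (j : Idx d) {U V : T.Opens} (hx : U ≤ x ⁻¹ᵁ chart k i) (hy : U ≤ y ⁻¹ᵁ chart k j) (t : Idx d)
    (h : V ≤ U) : (T.presheaf.map (homOfLE h).op).hom (A.bilinearValue x y i j U hx hy t) =
      A.bilinearValue x y i j V (h.trans hx) (h.trans hy) t := by
  simp only [bilinearValue, map_sum, map_mul, evalAt_res]

theorem bilinearValue_change (x : T ⟶ PP k (Fin (n + 1))) (y : T ⟶ PP k (Idx d))
    (i i' : Fin (n + 1)) (j j' : Idx d) (U : T.Opens) (hx : U ≤ x ⁻¹ᵁ chart k i)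
    (hy : U ≤ y ⁻¹ᵁ chart k j) (hx' : U ≤ x ⁻¹ᵁ chart k i') (hy' : U ≤ y ⁻¹ᵁ chart k j')
    (t : Idx d) : A.bilinearValue x y i j U hx hy t = A.bilinearValue x y i' j' U hx' hy' t *
      (evalAt x i U hx (X i') * evalAt y j U hy (X j')) := by
  rw [bilinearValue, bilinearValue, Finset.sum_mul]
  refine Finset.sum_congr rfl fun s _ => ?_
  rw [evalAt_change x i i' U hx hx' (A.isHomogeneous_entry s t),
    evalAt_change y j j' U hy hy' (isHomogeneous_X k s)]
  ring

theorem bilinearIdeal_eq {Y : Scheme.{u}} (x : Y ⟶ PP k (Fin (n + 1))) (y : Y ⟶ PP k (Idx d)) :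
    A.bilinearIdeal x y =
      idealSpan (fun c : Fin (n + 1) × Idx d => x ⁻¹ᵁ chart k c.1 ⊓ y ⁻¹ᵁ chart k c.2)
        (fun c => Set.range fun t : Idx d =>
          A.bilinearValue x y c.1 c.2 _ inf_le_left inf_le_right t) := by
  rw [bilinearIdeal]
  congr 1
  funext c
  congr 1
  funext t
  refine Finset.sum_congr rfl fun s _ => ?_
  rw [app_dehom, app_dehom, evalAt_res, evalAt_res]

theorem isCompatible_bilinear {Y : Scheme.{u}} (x : Y ⟶ PP k (Fin (n + 1)))
    (y : Y ⟶ PP k (Idx d)) :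
    IsCompatible (fun c : Fin (n + 1) × Idx d => x ⁻¹ᵁ chart k c.1 ⊓ y ⁻¹ᵁ chart k c.2)
        (fun c => Set.range fun t : Idx d =>
          A.bilinearValue x y c.1 c.2 _ inf_le_left inf_le_right t) := by
  rintro c c' p hp hp' _ ⟨t, rfl⟩
  let V := (x ⁻¹ᵁ chart k c.1 ⊓ y ⁻¹ᵁ chart k c.2) ⊓ (x ⁻¹ᵁ chart k c'.1 ⊓ y ⁻¹ᵁ chart k c'.2)
  have h1 : V ≤ x ⁻¹ᵁ chart k c.1 ⊓ y ⁻¹ᵁ chart k c.2 := inf_le_left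
  have h2 : V ≤ x ⁻¹ᵁ chart k c'.1 ⊓ y ⁻¹ᵁ chart k c'.2 := inf_le_right
  dsimp only
  rw [← germ_res_hom h1 p ⟨hp, hp'⟩, bilinearValue_res,
    A.bilinearValue_change x y c.1 c'.1 c.2 c'.2 V _ _ (h2.trans inf_le_left)
      (h2.trans inf_le_right), map_mul,
    ← A.bilinearValue_res x y c'.1 c'.2 inf_le_left inf_le_right t h2,
    germ_res_hom h2 p ⟨hp, hp'⟩]
  exact Ideal.mul_mem_right _ _ (Ideal.subset_span ⟨_, ⟨t, rfl⟩, rfl⟩)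

theorem iSup_inf_chart_eq_top {Y : Scheme.{u}} (x : Y ⟶ PP k (Fin (n + 1)))
    (y : Y ⟶ PP k (Idx d)) :
    ⨆ c : Fin (n + 1) × Idx d, x ⁻¹ᵁ chart k c.1 ⊓ y ⁻¹ᵁ chart k c.2 = ⊤ := by
  refine top_le_iff.1 fun p _ => ?_
  have hx : x p ∈ ⨆ i : Fin (n + 1), chart k i := by rw [iSup_chart_eq_top]; trivial
  have hy : y p ∈ ⨆ i : Idx d, chart k i := by rw [iSup_chart_eq_top]; trivial
  obtain ⟨i, hi⟩ := TopologicalSpace.Opens.mem_iSup.1 hx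
  obtain ⟨j, hj⟩ := TopologicalSpace.Opens.mem_iSup.1 hy
  exact TopologicalSpace.Opens.mem_iSup.2 ⟨(i, j), hi, hj⟩

theorem preimage_inf_le_left {Y X Z : Scheme.{u}} (h : T ⟶ Y) (x : Y ⟶ X) (y : Y ⟶ Z)
    (U : X.Opens) (V : Z.Opens) : h ⁻¹ᵁ (x ⁻¹ᵁ U ⊓ y ⁻¹ᵁ V) ≤ (h ≫ x) ⁻¹ᵁ U :=
  fun _ ht => ht.1

theorem preimage_inf_le_right {Y X Z : Scheme.{u}} (h : T ⟶ Y) (x : Y ⟶ X) (y : Y ⟶ Z)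
    (U : X.Opens) (V : Z.Opens) : h ⁻¹ᵁ (x ⁻¹ᵁ U ⊓ y ⁻¹ᵁ V) ≤ (h ≫ y) ⁻¹ᵁ V :=
  fun _ ht => ht.2

theorem le_preimage_inf {Y X Z : Scheme.{u}} (h : T ⟶ Y) (x : Y ⟶ X) (y : Y ⟶ Z)
    {U : X.Opens} {V : Z.Opens} {W : T.Opens} (h1 : W ≤ (h ≫ x) ⁻¹ᵁ U)
    (h2 : W ≤ (h ≫ y) ⁻¹ᵁ V) : W ≤ h ⁻¹ᵁ (x ⁻¹ᵁ U ⊓ y ⁻¹ᵁ V) :=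
  fun _ ht => ⟨h1 ht, h2 ht⟩

section

variable {Y : Scheme.{u}} (x : Y ⟶ PP k (Fin (n + 1))) (y : Y ⟶ PP k (Idx d)) (h : T ⟶ Y)

theorem bilinearIdeal_le_ker_iff :
    A.bilinearIdeal x y ≤ h.ker ↔ ∀ i j t,
      A.bilinearValue (h ≫ x) (h ≫ y) i j (h ⁻¹ᵁ (x ⁻¹ᵁ chart k i ⊓ y ⁻¹ᵁ chart k j))
        (preimage_inf_le_left _ _ _ _ _) (preimage_inf_le_right _ _ _ _ _) t = 0 := by
  have key : ∀ i j t, (h.app (x ⁻¹ᵁ chart k i ⊓ y ⁻¹ᵁ chart k j)).hom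
      (A.bilinearValue x y i j _ inf_le_left inf_le_right t) =
      A.bilinearValue (h ≫ x) (h ≫ y) i j (h ⁻¹ᵁ (x ⁻¹ᵁ chart k i ⊓ y ⁻¹ᵁ chart k j))
        (preimage_inf_le_left _ _ _ _ _) (preimage_inf_le_right _ _ _ _ _) t := by
    intro i j t
    rw [← Scheme.Hom.appLE_eq_app]
    simp only [bilinearValue, map_sum, map_mul, evalAt_comp]
  rw [bilinearIdeal_eq,
    (A.isCompatible_bilinear x y).idealSpan_le_ker_iff (iSup_inf_chart_eq_top x y)]
  constructor
  · intro H i j t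
    rw [← key]
    exact H (i, j) _ ⟨t, rfl⟩
  · rintro H ⟨i, j⟩ _ ⟨t, rfl⟩
    exact (key i j t).trans (H i j t)

theorem bilinearValue_eq_zero_of_le_ker (H : A.bilinearIdeal x y ≤ h.ker) (i : Fin (n + 1))
    (j : Idx d) (V : T.Opens) (hi : V ≤ (h ≫ x) ⁻¹ᵁ chart k i) (hj : V ≤ (h ≫ y) ⁻¹ᵁ chart k j)
    (t : Idx d) : A.bilinearValue (h ≫ x) (h ≫ y) i j V hi hj t = 0 := by
  rw [← A.bilinearValue_res (h ≫ x) (h ≫ y) i j (preimage_inf_le_left _ _ _ _ _)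
    (preimage_inf_le_right _ _ _ _ _) t (le_preimage_inf h x y hi hj),
    (A.bilinearIdeal_le_ker_iff x y h).1 H, map_zero]

theorem bilinearIdeal_le_ker_of_chart {i : Fin (n + 1)} {j : Idx d}
    (hi : ⊤ ≤ (h ≫ x) ⁻¹ᵁ chart k i) (hj : ⊤ ≤ (h ≫ y) ⁻¹ᵁ chart k j)
    (H : ∀ t, A.bilinearValue (h ≫ x) (h ≫ y) i j ⊤ hi hj t = 0) :
    A.bilinearIdeal x y ≤ h.ker := by
  refine (A.bilinearIdeal_le_ker_iff x y h).2 fun i' j' t => ?_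
  rw [A.bilinearValue_change _ _ i' i j' j _ _ _ (le_top.trans hi) (le_top.trans hj),
    ← A.bilinearValue_res _ _ i j hi hj t le_top, H, map_zero, zero_mul]

end

end BlockTensor

end

section

/-! ### Points of the incidence scheme -/

variable {k : Type u} [Field k] {ι : Type} {T : Scheme.{u}}

theorem mem_pointIdeal_of_le_ker {G : Set (MvPolynomial ι k)} {y : T ⟶ PP k ι}
    (h : projIdeal G ≤ y.ker) {F : MvPolynomial ι k} (hG : F ∈ G) {e : ℕ} (hF : F.IsHomogeneous e)
    (t : T) : F ∈ pointIdeal (y t) := by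
  have hy : y t ∈ ⨆ i : ι, chart k i := by rw [iSup_chart_eq_top]; trivial
  obtain ⟨i, hi⟩ := TopologicalSpace.Opens.mem_iSup.1 hy
  have h0 := evalAt_eq_zero_of_le_ker h hG hF i (y ⁻¹ᵁ chart k i) le_rfl
  have h1 := basicOpen_evalAt y i (y ⁻¹ᵁ chart k i) le_rfl hF (t := t) hi
  rw [h0, Scheme.basicOpen_zero] at h1
  by_contra h2
  exact (h1.2 h2).elim

namespace BlockTensor

variable {n r : ℕ} {d : Fin r → ℕ} (A : BlockTensor k n r d)

theorem XneToPP_mem (z : A.Xne) : A.XneToPP z ∈ A.corankLEOne :=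
  (((projIdeal (Set.range A.detForm)).comap A.corankLEOne.ι).subschemeι z).2

theorem projIdeal_detForm_le_ker (g : T ⟶ A.Xne) :
    projIdeal (Set.range A.detForm) ≤ (g ≫ A.XneToPP).ker := by
  let I := (projIdeal (Set.range A.detForm)).comap A.corankLEOne.ι
  exact (comap_le_ker_iff _ A.corankLEOne.ι (g ≫ I.subschemeι)).1 (le_ker_comp_subschemeι I g)

theorem evalAt_detForm (g : T ⟶ A.Xne) (i : Fin (n + 1)) (U : T.Opens)
    (hU : U ≤ (g ≫ A.XneToPP) ⁻¹ᵁ chart k i) (l : Fin r) :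
    evalAt (g ≫ A.XneToPP) i U hU (A.detForm l) = 0 :=
  evalAt_eq_zero_of_le_ker (A.projIdeal_detForm_le_ker g) ⟨l, rfl⟩ (A.isHomogeneous_detForm l)
    i U hU

theorem detForm_mem_pointIdeal (z : A.Xne) (l : Fin r) :
    A.detForm l ∈ pointIdeal (A.XneToPP z) := by
  have h := mem_pointIdeal_of_le_ker (A.projIdeal_detForm_le_ker (𝟙 _)) ⟨l, rfl⟩
    (A.isHomogeneous_detForm l) z
  rwa [Category.id_comp] at h

theorem singIdeal_le_ker_iff (g : T ⟶ A.Xne) :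
    A.singIdeal ≤ g.ker ↔ projIdeal (Set.range fun e : Fin r → Fin (n + 1) =>
      ((jacobian A.detForm).submatrix id e).det) ≤ (g ≫ A.XneToPP).ker :=
  comap_le_ker_iff _ _ _

theorem isHomogeneous_quadric (j : Fin (n + 1)) : (A.quadric j).IsHomogeneous 2 :=
  IsHomogeneous.sum _ _ _ fun s _ => IsHomogeneous.sum _ _ _ fun t _ => by
    simpa using ((isHomogeneous_C (Idx d) (A.fullSlice j s t)).mul (isHomogeneous_X k s)).mul
      (isHomogeneous_X k t)

theorem evalAt_quadric {x : T ⟶ PP k (Fin (n + 1))} {y : T ⟶ PP k (Idx d)}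
    (hxy : x ≫ PP.toSpec k _ = y ≫ PP.toSpec k _) (i : Fin (n + 1)) (j : Idx d) (V : T.Opens)
    (hx : V ≤ x ⁻¹ᵁ chart k i) (hy : V ≤ y ⁻¹ᵁ chart k j) (j' : Fin (n + 1)) :
    evalAt y j V hy (A.quadric j') = ∑ s, ∑ t, evalAt x i V hx (C (A.fullSlice j' s t)) *
      evalAt y j V hy (X s) * evalAt y j V hy (X t) := by
  simp only [quadric, map_sum, map_mul, evalAt_C, hxy]

/-- The inclusion of the incidence scheme in `X^{n.e.} × ℙᵐ`. -/
def incidenceι : A.incidence ⟶ A.product := A.incidenceIdeal.subschemeι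

/-- The inclusion of the singular subscheme in `X^{n.e.}`. -/
def singι : A.singXne ⟶ A.Xne := A.singIdeal.subschemeι

instance : Mono A.incidenceι := inferInstanceAs (Mono A.incidenceIdeal.subschemeι)

instance : Mono A.singι := inferInstanceAs (Mono A.singIdeal.subschemeι)

theorem incidenceFst_eq : A.incidenceFst =
    A.incidenceι ≫ pullback.fst (A.XneToPP ≫ PP.toSpec k (Fin (n + 1))) (PP.toSpec k (Idx d)) :=
  rfl

/-- The point of `ℙⁿ` underlying a point of the product. -/
def productX : A.product ⟶ PP k (Fin (n + 1)) := pullback.fst _ _ ≫ A.XneToPP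

/-- The second projection from the product. -/
def productY : A.product ⟶ PP k (Idx d) := pullback.snd _ _

theorem productX_toSpec : A.productX ≫ PP.toSpec k _ = A.productY ≫ PP.toSpec k _ := by
  rw [productX, productY, Category.assoc, pullback.condition]

theorem incidenceIdeal_le_ker_iff (h : T ⟶ A.product) : A.incidenceIdeal ≤ h.ker ↔
    A.bilinearIdeal A.productX A.productY ≤ h.ker ∧
      projIdeal (Set.range A.quadric) ≤ (h ≫ A.productY).ker := by
  rw [← comap_le_ker_iff, ← sup_le_iff]
  rfl

section

variable {h : T ⟶ A.product} {x : T ⟶ PP k (Fin (n + 1))} {y : T ⟶ PP k (Idx d)}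

/-- The coordinates of a point of the incidence scheme satisfy the incidence equations. -/
theorem isIncident_of_le_ker (hx : h ≫ A.productX = x) (hy : h ≫ A.productY = y)
    (H : A.incidenceIdeal ≤ h.ker) (i : Fin (n + 1)) (j : Idx d)
    (V : T.Opens) (hi : V ≤ x ⁻¹ᵁ chart k i) (hj : V ≤ y ⁻¹ᵁ chart k j) :
    A.IsIncident (evalAt x i V hi) (fun s => evalAt y j V hj (X s)) := by
  subst hx hy
  rw [incidenceIdeal_le_ker_iff] at H
  refine ⟨A.bilinearValue_eq_zero_of_le_ker _ _ h H.1 i j V hi hj, fun j' => ?_⟩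
  rw [← A.evalAt_quadric (by rw [Category.assoc, Category.assoc, productX_toSpec]) i j V hi hj]
  exact evalAt_eq_zero_of_le_ker H.2 ⟨j', rfl⟩ (A.isHomogeneous_quadric j') j V hj

theorem le_ker_of_isIncident (hx : h ≫ A.productX = x) (hy : h ≫ A.productY = y)
    {i : Fin (n + 1)} {j : Idx d}
    (hi : ⊤ ≤ x ⁻¹ᵁ chart k i) (hj : ⊤ ≤ y ⁻¹ᵁ chart k j)
    (H : A.IsIncident (evalAt x i ⊤ hi) (fun s => evalAt y j ⊤ hj (X s))) :
    A.incidenceIdeal ≤ h.ker := by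
  subst hx hy
  rw [incidenceIdeal_le_ker_iff]
  refine ⟨A.bilinearIdeal_le_ker_of_chart _ _ h hi hj H.bilinear,
    projIdeal_le_ker_of_chart hj ?_⟩
  rintro _ ⟨j', rfl⟩
  rw [A.evalAt_quadric (by rw [Category.assoc, Category.assoc, productX_toSpec]) i j ⊤ hi hj]
  exact H.quadric j'

end

theorem evalAt_minor (g : T ⟶ A.singXne) (i : Fin (n + 1)) (U : T.Opens)
    (hU : U ≤ ((g ≫ A.singι) ≫ A.XneToPP) ⁻¹ᵁ chart k i)
    (e : Fin r → Fin (n + 1)) : evalAt ((g ≫ A.singι) ≫ A.XneToPP) i U hU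
      ((jacobian A.detForm).submatrix id e).det = 0 :=
  evalAt_eq_zero_of_le_ker ((A.singIdeal_le_ker_iff _).1 (le_ker_comp_subschemeι _ g)) ⟨e, rfl⟩
    (A.isHomogeneous_jacobian_minor _ _) i U hU

theorem exists_adjugate_notMem_XneToPP (hd : ∀ l, d l ≠ 0) (z : A.Xne) :
    ∃ i : ∀ l, Fin (d l), ∀ l, (A.blockMatrix l).adjugate (i l) (i l) ∉
      pointIdeal (A.XneToPP z) := by
  choose i hi using fun l => A.exists_adjugate_notMem (A.XneToPP_mem z) (hd l)
    (A.detForm_mem_pointIdeal z l)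
  exact ⟨i, hi⟩

/-- The first projection from the incidence scheme factors through the singular subscheme. -/
theorem singIdeal_le_ker_incidenceFst (hd : ∀ l, d l ≠ 0) :
    A.singIdeal ≤ A.incidenceFst.ker := by
  let x : A.incidence ⟶ PP k (Fin (n + 1)) := A.incidenceι ≫ A.productX
  have hx : A.incidenceFst ≫ A.XneToPP = x := by
    rw [incidenceFst_eq, Category.assoc]
    rfl
  let y : A.incidence ⟶ PP k (Idx d) := A.incidenceι ≫ A.productY
  rw [singIdeal_le_ker_iff, hx, projIdeal_le_ker_iff]
  rintro i e _ ⟨e', rfl⟩ -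
  have hdet := fun l V hV => A.evalAt_detForm A.incidenceFst i V hV l
  have ha' := fun t => A.exists_adjugate_notMem_XneToPP hd (A.incidenceFst t)
  simp only [← Scheme.Hom.comp_apply] at ha'
  simp only [hx] at hdet ha'
  -- The pivot indices and the chart containing `y` vary with the point, so the vanishing of the
  -- minors is proved on the neighbourhood `V` where one choice works.
  refine section_eq_zero_of_locally fun t ht => ?_
  obtain ⟨a, ha⟩ := ha' t
  have hyt : y t ∈ ⨆ j : Idx d, chart k j := by rw [iSup_chart_eq_top]; trivial
  obtain ⟨j, hj⟩ := TopologicalSpace.Opens.mem_iSup.1 hyt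
  choose ea hea using fun l => A.isHomogeneous_adjugate l (a l) (a l)
  let V : A.incidence.Opens := (x ⁻¹ᵁ chart k i ⊓ y ⁻¹ᵁ chart k j) ⊓
    x ⁻¹ᵁ (⨅ l, Proj.basicOpen (grading k _) ((A.blockMatrix l).adjugate (a l) (a l)))
  have hV : V ≤ x ⁻¹ᵁ chart k i := inf_le_left.trans inf_le_left
  have hV' : V ≤ y ⁻¹ᵁ chart k j := inf_le_left.trans inf_le_right
  have hVa : ∀ l, ∀ t ∈ V, (A.blockMatrix l).adjugate (a l) (a l) ∉ pointIdeal (x t) := by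
    intro l t ht
    exact (iInf_le (fun l => Proj.basicOpen (grading k (Fin (n + 1)))
      ((A.blockMatrix l).adjugate (a l) (a l))) l) ht.2
  refine ⟨V, hV, ⟨⟨ht, hj⟩, ?_⟩, ?_⟩
  · change x t ∈ (⨅ l, Proj.basicOpen (grading k (Fin (n + 1)))
      ((A.blockMatrix l).adjugate (a l) (a l)) : (PP k (Fin (n + 1))).Opens)
    rw [← SetLike.mem_coe, TopologicalSpace.Opens.coe_iInf]
    exact Set.mem_iInter.2 fun l => ha l
  · rw [evalAt_res]
    exact (A.isIncident_of_le_ker rfl rfl (le_of_eq A.incidenceIdeal.ker_subschemeι.symm)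
      i j V hV hV').jacobian_minor_eq_zero A (fun l => hdet l V hV)
      (fun l => isUnit_evalAt x i V hV (hea l) (hVa l))
      (evalAt_X_self y j V hV') e'

end BlockTensor

end

section

/-! ### The local structure of the incidence scheme -/

variable {k : Type u} [Field k] {ι : Type} {T T' : Scheme.{u}}

/-- The form in which the local model is compared with the incidence scheme: existence and
uniqueness for `T`-valued points. -/
theorem isPullback_of_exists {C : Type*} [Category* C] {Q X P S : C} {v : Q ⟶ X} {q : Q ⟶ P}
    {f : X ⟶ S} {g : P ⟶ S} (h : v ≫ f = q ≫ g)
    (hex : ∀ (T : C) (u : T ⟶ X) (w : T ⟶ P), u ≫ f = w ≫ g → ∃ l : T ⟶ Q, l ≫ v = u ∧ l ≫ q = w)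
    (huniq : ∀ (T : C) (l l' : T ⟶ Q), l ≫ v = l' ≫ v → l ≫ q = l' ≫ q → l = l') :
    IsPullback v q f g := by
  refine ⟨⟨h⟩, ⟨PullbackCone.isLimitAux' _ fun s => ?_⟩⟩
  have hl := hex s.pt s.fst s.snd s.condition
  exact ⟨hl.choose, hl.choose_spec.1, hl.choose_spec.2, fun {l} h1 h2 =>
    huniq _ _ _ (h1.trans hl.choose_spec.1.symm) (h2.trans hl.choose_spec.2.symm)⟩

theorem top_le_preimage_comp {Y : Scheme.{u}} (g : T' ⟶ T) {y : T ⟶ Y} {U : Y.Opens}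
    (h : ⊤ ≤ y ⁻¹ᵁ U) : ⊤ ≤ (g ≫ y) ⁻¹ᵁ U := by
  rw [Scheme.Hom.comp_preimage]
  exact (le_preimage_top g ⊤).trans (Scheme.Hom.preimage_mono g h)

theorem appTop_evalAt (g : T' ⟶ T) {y : T ⟶ PP k ι} {i : ι} (h : ⊤ ≤ y ⁻¹ᵁ chart k i)
    (F : MvPolynomial ι k) : g.appTop.hom (evalAt y i ⊤ h F) =
      evalAt (g ≫ y) i ⊤ (top_le_preimage_comp g h) F := by
  rw [← appLE_top, evalAt_comp]

theorem evalAt_congr {y y' : T ⟶ PP k ι} (h : y = y') (i : ι) (U : T.Opens)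
    (hU : U ≤ y ⁻¹ᵁ chart k i) (F : MvPolynomial ι k) :
    evalAt y i U hU F = evalAt y' i U (h ▸ hU) F := by
  subst h
  rfl

namespace BlockTensor

variable {n r : ℕ} {d : Fin (r + 1) → ℕ} (A : BlockTensor k n (r + 1) d)

/-- The point of `ℙⁿ` underlying a point of the singular subscheme. -/
def singX : A.singXne ⟶ PP k (Fin (n + 1)) := A.singι ≫ A.XneToPP

theorem evalAt_singX_detForm (p : T ⟶ A.singXne) {i : Fin (n + 1)}
    (hi : ⊤ ≤ (p ≫ A.singX) ⁻¹ᵁ chart k i) (l : Fin (r + 1)) :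
    evalAt (p ≫ A.singX) i ⊤ hi (A.detForm l) = 0 :=
  (evalAt_congr (Category.assoc p A.singι A.XneToPP).symm i ⊤ hi _).trans
    (A.evalAt_detForm (p ≫ A.singι) i ⊤ _ l)

theorem evalAt_singX_minor (p : T ⟶ A.singXne) {i : Fin (n + 1)}
    (hi : ⊤ ≤ (p ≫ A.singX) ⁻¹ᵁ chart k i) (e : Fin (r + 1) → Fin (n + 1)) :
    evalAt (p ≫ A.singX) i ⊤ hi ((jacobian A.detForm).submatrix id e).det = 0 :=
  (evalAt_congr (Category.assoc p A.singι A.XneToPP).symm i ⊤ hi _).trans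
    (A.evalAt_minor p i ⊤ _ e)

variable {i : Fin (n + 1)} {a : ∀ l, Fin (d l)} {o : Fin (r + 1)} {e : Fin r → Fin (n + 1)}

/-- Near a point of the singular subscheme the second projection from the incidence scheme takes
values in a single chart. -/
theorem top_le_preimage_chart {h : T ⟶ A.product} {x : T ⟶ PP k (Fin (n + 1))}
    {y : T ⟶ PP k (Idx d)} (hx : h ≫ A.productX = x) (hy : h ≫ A.productY = y)
    (H : A.incidenceIdeal ≤ h.ker) (hi : ⊤ ≤ x ⁻¹ᵁ chart k i)
    (hdet : ∀ l, evalAt x i ⊤ hi (A.detForm l) = 0)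
    (hJ : ∀ e : Fin (r + 1) → Fin (n + 1),
      evalAt x i ⊤ hi ((jacobian A.detForm).submatrix id e).det = 0)
    (ha : ∀ l, IsUnit (evalAt x i ⊤ hi ((A.blockMatrix l).adjugate (a l) (a l))))
    (hm : IsUnit (evalAt x i ⊤ hi (A.jacobianMinor e o))) :
    ⊤ ≤ y ⁻¹ᵁ chart k (⟨o, a o⟩ : Idx d) := by
  intro t _
  have hyt : y t ∈ ⨆ j : Idx d, chart k j := by rw [iSup_chart_eq_top]; trivial
  obtain ⟨j, hj⟩ := TopologicalSpace.Opens.mem_iSup.1 hyt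
  -- Over `V` the coordinates are normalized by `y_j = 1`, so `IsIncident.isUnit` applies and moves
  -- the point into the chart of the pivot of block `o`.
  let V := y ⁻¹ᵁ chart k j
  have hV : V ≤ x ⁻¹ᵁ chart k i := le_top.trans hi
  have hres : ∀ F, evalAt x i V hV F =
      (T.presheaf.map (homOfLE (le_top : V ≤ ⊤)).op).hom (evalAt x i ⊤ hi F) := fun F =>
    (evalAt_res x i hi le_top F).symm
  refine mem_chart_of_isUnit y j _ V le_rfl ?_ hj
  refine (A.isIncident_of_le_ker hx hy H i j V hV le_rfl).isUnit A (i := a) (e := e) ?_ ?_ ?_ ?_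
    (evalAt_X_self y j V le_rfl)
  · intro l
    rw [hres, hdet, map_zero]
  · intro e
    rw [hres, hJ, map_zero]
  · intro l
    rw [hres]
    exact (ha l).map _
  · rw [hres]
    exact hm.map _

/-- The second projection from the incidence scheme. -/
def incidenceSnd : A.incidence ⟶ PP k (Idx d) := A.incidenceι ≫ A.productY

theorem comp_incidenceι_productX {u : T ⟶ A.incidence} {w : T ⟶ A.singXne}
    (huw : u ≫ A.incidenceFst = w ≫ A.singι) :
    (u ≫ A.incidenceι) ≫ A.productX = w ≫ A.singX := by
  rw [singX, ← Category.assoc, ← huw, incidenceFst_eq, productX]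
  simp only [Category.assoc]

theorem comp_incidenceSnd_toSpec {u : T ⟶ A.incidence} {w : T ⟶ A.singXne}
    (huw : u ≫ A.incidenceFst = w ≫ A.singι) :
    (u ≫ A.incidenceSnd) ≫ PP.toSpec k _ = (w ≫ A.singX) ≫ PP.toSpec k _ := by
  rw [← A.comp_incidenceι_productX huw, incidenceSnd]
  simp only [Category.assoc, productX_toSpec]

theorem incidence_hom_ext {u u' : T ⟶ A.incidence} (h : u ≫ A.incidenceFst = u' ≫ A.incidenceFst)
    (h' : u ≫ A.incidenceSnd = u' ≫ A.incidenceSnd) : u = u' := by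
  rw [← cancel_mono A.incidenceι]
  refine pullback.hom_ext ?_ ?_
  · rw [Category.assoc, Category.assoc, ← incidenceFst_eq, h]
  · exact (Category.assoc _ _ _).trans (h'.trans (Category.assoc _ _ _).symm)

section Points

variable {w : T ⟶ A.singXne} (hi : ⊤ ≤ (w ≫ A.singX) ⁻¹ᵁ chart k i) {α : Fin (r + 1) → Γ(T, ⊤)}
  {m : Γ(T, ⊤)}

/-- Points of the incidence scheme are given by square roots. -/
theorem incidence_coordinates {u : T ⟶ A.incidence} (huw : u ≫ A.incidenceFst = w ≫ A.singι)
    (hα : ∀ l, α l * evalAt (w ≫ A.singX) i ⊤ hi ((A.blockMatrix l).adjugate (a l) (a l)) = 1)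
    (hm : m * evalAt (w ≫ A.singX) i ⊤ hi (A.jacobianMinor e o) = 1) :
    ∃ hy : ⊤ ≤ (u ≫ A.incidenceSnd) ⁻¹ᵁ chart k (⟨o, a o⟩ : Idx d),
      (∀ l, evalAt (u ≫ A.incidenceSnd) _ ⊤ hy (X ⟨l, a l⟩) ^ 2 =
        evalAt (w ≫ A.singX) i ⊤ hi ((A.blockMatrix l).adjugate (a l) (a l)) * α o *
          (evalAt (w ≫ A.singX) i ⊤ hi (A.jacobianMinor e l) * m)) ∧
      ∀ l t, evalAt (u ≫ A.incidenceSnd) _ ⊤ hy (X ⟨l, t⟩) =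
        α l * evalAt (w ≫ A.singX) i ⊤ hi ((A.blockMatrix l).adjugate t (a l)) *
          evalAt (u ≫ A.incidenceSnd) _ ⊤ hy (X ⟨l, a l⟩) := by
  have hX := A.comp_incidenceι_productX huw
  have hY : (u ≫ A.incidenceι) ≫ A.productY = u ≫ A.incidenceSnd := Category.assoc _ _ _
  have hinc : A.incidenceIdeal ≤ (u ≫ A.incidenceι).ker :=
    le_ker_comp_subschemeι A.incidenceIdeal u
  have hdet := A.evalAt_singX_detForm w hi
  have hJ := A.evalAt_singX_minor w hi
  have hy := A.top_le_preimage_chart hX hY hinc hi hdet hJ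
    (fun l => IsUnit.of_mul_eq_one_right _ (hα l)) (IsUnit.of_mul_eq_one_right _ hm)
  have hT := A.isIncident_of_le_ker hX hY hinc i _ ⊤ hi hy
  refine ⟨hy, hT.sq_eq A hdet hJ hα hm (evalAt_X_self _ _ ⊤ hy), fun l t => ?_⟩
  have h1 := hT.mul_eq A hdet (IsUnit.of_mul_eq_one_right _ (hα l)) t
  rw [mul_assoc, ← h1, ← mul_assoc, hα, one_mul]

/-- Square roots give points of the incidence scheme. -/
theorem exists_incidence_point {c : Fin (r + 1) → Γ(T, ⊤)}
    (hα : ∀ l, α l * evalAt (w ≫ A.singX) i ⊤ hi ((A.blockMatrix l).adjugate (a l) (a l)) = 1)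
    (hco : c o = 1)
    (hc : ∀ l, c l ^ 2 =
      evalAt (w ≫ A.singX) i ⊤ hi ((A.blockMatrix l).adjugate (a l) (a l)) * α o *
        (evalAt (w ≫ A.singX) i ⊤ hi (A.jacobianMinor e l) * m)) :
    ∃ (v : T ⟶ A.incidence) (hy : ⊤ ≤ (v ≫ A.incidenceSnd) ⁻¹ᵁ chart k (⟨o, a o⟩ : Idx d)),
      v ≫ A.incidenceFst = w ≫ A.singι ∧
      ∀ l t, evalAt (v ≫ A.incidenceSnd) _ ⊤ hy (X ⟨l, t⟩) =
        α l * evalAt (w ≫ A.singX) i ⊤ hi ((A.blockMatrix l).adjugate t (a l)) * c l := by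
  have hdet := A.evalAt_singX_detForm w hi
  have hJ := A.evalAt_singX_minor w hi
  obtain ⟨y, hy, hyk, hyX⟩ := exists_hom_of_coordinates
    ((w ≫ A.singX) ≫ PP.toSpec k (Fin (n + 1))) (⟨o, a o⟩ : Idx d)
    (fun s => α s.1 * evalAt (w ≫ A.singX) i ⊤ hi ((A.blockMatrix s.1).adjugate s.2 (a s.1)) *
      c s.1) (by rw [hα, hco, one_mul])
  let h : T ⟶ A.product := pullback.lift (w ≫ A.singι) y (by
    rw [hyk, singX]
    simp only [Category.assoc])
  have hX : h ≫ A.productX = w ≫ A.singX := by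
    rw [productX, pullback.lift_fst_assoc, singX, Category.assoc]
  have hY : h ≫ A.productY = y := pullback.lift_snd _ _ _
  have hinc : A.incidenceIdeal ≤ h.ker := by
    refine A.le_ker_of_isIncident hX hY hi hy ?_
    rw [funext hyX]
    exact A.isIncident_of_sq_eq hdet hJ hα hc
  obtain ⟨v, hv⟩ : ∃ v : T ⟶ A.incidence, v ≫ A.incidenceι = h := exists_lift_subscheme hinc
  have hvy : y = v ≫ A.incidenceSnd := by rw [incidenceSnd, ← Category.assoc, hv, hY]
  subst hvy
  refine ⟨v, hy, ?_, fun l t => hyX ⟨l, t⟩⟩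
  rw [incidenceFst_eq, ← Category.assoc, hv]
  exact pullback.lift_fst _ _ _

end Points

theorem appTop_evalAt_singX {P : Scheme.{u}} (g : T ⟶ P) {p : P ⟶ A.singXne} {w : T ⟶ A.singXne}
    (h : g ≫ p = w) (hi : ⊤ ≤ (p ≫ A.singX) ⁻¹ᵁ chart k i)
    (hi' : ⊤ ≤ (w ≫ A.singX) ⁻¹ᵁ chart k i) (F : MvPolynomial (Fin (n + 1)) k) :
    g.appTop.hom (evalAt (p ≫ A.singX) i ⊤ hi F) = evalAt (w ≫ A.singX) i ⊤ hi' F := by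
  rw [appTop_evalAt g hi]
  exact evalAt_congr (by rw [← h, Category.assoc]) _ _ _ _

theorem appTop_evalAt_incidenceSnd {Q : Scheme.{u}} (g : T ⟶ Q) {v : Q ⟶ A.incidence}
    {u : T ⟶ A.incidence} (h : g ≫ v = u) {j : Idx d}
    (hj : ⊤ ≤ (v ≫ A.incidenceSnd) ⁻¹ᵁ chart k j) (hj' : ⊤ ≤ (u ≫ A.incidenceSnd) ⁻¹ᵁ chart k j)
    (F : MvPolynomial (Idx d) k) :
    g.appTop.hom (evalAt (v ≫ A.incidenceSnd) j ⊤ hj F) =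
      evalAt (u ≫ A.incidenceSnd) j ⊤ hj' F := by
  rw [appTop_evalAt g hj]
  exact evalAt_congr (by rw [← h, Category.assoc]) _ _ _ _

theorem top_le_preimage_singX {P : Scheme.{u}} (g : T ⟶ P) {p : P ⟶ A.singXne}
    (hi : ⊤ ≤ (p ≫ A.singX) ⁻¹ᵁ chart k i) : ⊤ ≤ ((g ≫ p) ≫ A.singX) ⁻¹ᵁ chart k i := by
  rw [Category.assoc]
  exact top_le_preimage_comp g hi

theorem top_le_preimage_incidenceSnd {Q : Scheme.{u}} (g : T ⟶ Q) {v : Q ⟶ A.incidence}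
    {j : Idx d} (hj : ⊤ ≤ (v ≫ A.incidenceSnd) ⁻¹ᵁ chart k j) :
    ⊤ ≤ ((g ≫ v) ≫ A.incidenceSnd) ⁻¹ᵁ chart k j := by
  rw [Category.assoc]
  exact top_le_preimage_comp g hj

/-- Locally over the singular subscheme, the incidence scheme is obtained by adjoining square
roots of functions. -/
theorem exists_isPullback {π : A.incidence ⟶ A.singXne} (hπ : π ≫ A.singι = A.incidenceFst)
    {P : Scheme.{u}} (p : P ⟶ A.singXne) (hi : ⊤ ≤ (p ≫ A.singX) ⁻¹ᵁ chart k i)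
    (ha : ∀ l, IsUnit (evalAt (p ≫ A.singX) i ⊤ hi ((A.blockMatrix l).adjugate (a l) (a l))))
    (hm : IsUnit (evalAt (p ≫ A.singX) i ⊤ hi (A.jacobianMinor e o))) :
    ∃ (Q : Scheme.{u}) (q : Q ⟶ P) (v : Q ⟶ A.incidence),
      (IsFinite q ∧ Flat q ∧ ∀ z, q.finrank z = 2 ^ r) ∧ IsPullback v q π p := by
  choose α hα using fun l => (ha l).exists_left_inv
  obtain ⟨m, hm'⟩ := hm.exists_left_inv
  obtain ⟨b, hb⟩ : ∃ b : Fin (r + 1) → Γ(P, ⊤), ∀ l, b l =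
      evalAt (p ≫ A.singX) i ⊤ hi ((A.blockMatrix l).adjugate (a l) (a l)) * α o *
        (evalAt (p ≫ A.singX) i ⊤ hi (A.jacobianMinor e l) * m) := ⟨_, fun _ => rfl⟩
  -- The normalized pivot needs no root to be adjoined: only the `r` blocks other than `o`
  -- contribute, whence the exponent `r` for `r + 1` blocks.
  have hbo : b o = 1 := by
    rw [hb, mul_comm _ (α o), hα, mul_comm _ m, hm', one_mul]
  have hαw : ∀ (T : Scheme.{u}) (w : T ⟶ P) (l), w.appTop.hom (α l) *
      evalAt ((w ≫ p) ≫ A.singX) i ⊤ (A.top_le_preimage_singX w hi)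
        ((A.blockMatrix l).adjugate (a l) (a l)) = 1 := fun T w l => by
    rw [← A.appTop_evalAt_singX w rfl hi, ← map_mul, hα, map_one]
  have hmw : ∀ (T : Scheme.{u}) (w : T ⟶ P), w.appTop.hom m *
      evalAt ((w ≫ p) ≫ A.singX) i ⊤ (A.top_le_preimage_singX w hi) (A.jacobianMinor e o) = 1 :=
    fun T w => by rw [← A.appTop_evalAt_singX w rfl hi, ← map_mul, hm', map_one]
  have hbw : ∀ (T : Scheme.{u}) (w : T ⟶ P) (l), w.appTop.hom (b l) =
      evalAt ((w ≫ p) ≫ A.singX) i ⊤ (A.top_le_preimage_singX w hi)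
        ((A.blockMatrix l).adjugate (a l) (a l)) * w.appTop.hom (α o) *
      (evalAt ((w ≫ p) ≫ A.singX) i ⊤ (A.top_le_preimage_singX w hi) (A.jacobianMinor e l) *
        w.appTop.hom m) := fun T w l => by
    rw [hb, map_mul, map_mul, map_mul, A.appTop_evalAt_singX w rfl hi,
      A.appTop_evalAt_singX w rfl hi]
  obtain ⟨Q, q, c', hq, hc', huniq, hex⟩ := exists_sqrt_cover fun l => b (o.succAbove l)
  obtain ⟨c, hco, hcs⟩ : ∃ c : Fin (r + 1) → Γ(Q, ⊤), c o = 1 ∧ ∀ l, c (o.succAbove l) = c' l :=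
    ⟨o.insertNth 1 c', Fin.insertNth_apply_same _ _ _,
      fun l => Fin.insertNth_apply_succAbove _ _ _ _⟩
  have hc : ∀ l, c l ^ 2 = q.appTop.hom (b l) := by
    intro l
    rcases Fin.eq_self_or_eq_succAbove o l with rfl | ⟨l, rfl⟩
    · rw [hco, hbo, map_one, one_pow]
    · rw [hcs, hc']
  obtain ⟨v, hy, hvf, hvX⟩ := A.exists_incidence_point (A.top_le_preimage_singX q hi) (hαw Q q)
    hco (fun l => (hc l).trans (hbw Q q l))
  have hvc : ∀ l, evalAt (v ≫ A.incidenceSnd) _ ⊤ hy (X ⟨l, a l⟩) = c l := fun l => by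
    rw [hvX, hαw, one_mul]
  refine ⟨Q, q, v, hq, isPullback_of_exists ?_ (fun T u w huw => ?_) fun T g g' h1 h2 => ?_⟩
  · rw [← cancel_mono A.singι, Category.assoc, hπ, hvf]
  -- The pivots of the given point have squares `b l`, so they define a morphism `g` to the cover.
  -- The points `g ≫ v` and `u` agree because all other coordinates are determined by the pivots.
  · have huf : u ≫ A.incidenceFst = (w ≫ p) ≫ A.singι := by
      rw [← hπ, ← Category.assoc, huw]
    obtain ⟨hyu, husq, huX⟩ := A.incidence_coordinates (A.top_le_preimage_singX w hi) huf
      (hαw T w) (hmw T w)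
    obtain ⟨g, hgq, hgc⟩ := hex T w
      (fun l => evalAt (u ≫ A.incidenceSnd) _ ⊤ hyu (X ⟨o.succAbove l, a _⟩))
      fun l => (husq _).trans (hbw T w _).symm
    have hgc' : ∀ l, g.appTop.hom (c l) =
        evalAt (u ≫ A.incidenceSnd) _ ⊤ hyu (X ⟨l, a l⟩) := by
      intro l
      rcases Fin.eq_self_or_eq_succAbove o l with rfl | ⟨l, rfl⟩
      · rw [hco, map_one, evalAt_X_self]
      · rw [hcs, hgc]
    have hgf : (g ≫ v) ≫ A.incidenceFst = (w ≫ p) ≫ A.singι := by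
      rw [Category.assoc, hvf, ← Category.assoc, ← Category.assoc, hgq]
    have hα' : ∀ l, g.appTop.hom (q.appTop.hom (α l)) = w.appTop.hom (α l) := fun l => by
      rw [← CommRingCat.comp_apply, ← Scheme.Hom.comp_appTop, hgq]
    refine ⟨g, A.incidence_hom_ext (hgf.trans huf.symm) ?_, hgq⟩
    refine hom_ext_of_evalAt _ (A.top_le_preimage_incidenceSnd g hy) hyu ?_ fun ⟨l, t⟩ => ?_
    · rw [A.comp_incidenceSnd_toSpec hgf, A.comp_incidenceSnd_toSpec huf]
    · rw [← A.appTop_evalAt_incidenceSnd g rfl hy, hvX, huX, map_mul, map_mul, hα', hgc',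
        A.appTop_evalAt_singX g (by rw [← Category.assoc, hgq])]
  -- The adjoined roots are themselves coordinates of `v`, so they agree on `g` and `g'`.
  · refine huniq _ _ _ h2 fun l => ?_
    rw [← hcs, ← hvc, A.appTop_evalAt_incidenceSnd g rfl hy
        (A.top_le_preimage_incidenceSnd g hy), A.appTop_evalAt_incidenceSnd g' h1.symm hy
        (A.top_le_preimage_incidenceSnd g hy)]

end BlockTensor

end

/-! ### Gluing the local covers over the singular subscheme. -/

section

namespace BlockTensor

variable {k : Type u} [Field k] {n r : ℕ} {d : Fin (r + 1) → ℕ} (A : BlockTensor k n (r + 1) d)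

theorem isHomogeneous_jacobianMinor (e : Fin r → Fin (n + 1)) (l : Fin (r + 1)) :
    ∃ m, (A.jacobianMinor e l).IsHomogeneous m := by
  have h := (isHomogeneous_C (Fin (n + 1)) ((-1 : k) ^ (l : ℕ))).mul
    (A.isHomogeneous_jacobian_minor l.succAbove e)
  rw [map_pow, map_neg, map_one] at h
  exact ⟨_, h⟩

theorem jacobianMinor_notMem {p : PP k (Fin (n + 1))} {l : Fin (r + 1)} {e : Fin r → Fin (n + 1)}
    (h : ((jacobian A.detForm).submatrix l.succAbove e).det ∉ pointIdeal p) :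
    A.jacobianMinor e l ∉ pointIdeal p := by
  intro h1
  rcases (inferInstance : (pointIdeal p).IsPrime).mem_or_mem h1 with h2 | h2
  · exact (inferInstance : (pointIdeal p).IsPrime).ne_top
      (Ideal.eq_top_of_isUnit_mem _ h2 ((isUnit_one.neg).pow _))
  · exact h h2

/-- Every point of the singular subscheme has a neighbourhood over which the incidence scheme is a
finite flat cover of degree `2 ^ r`. -/
theorem exists_opens_isPullback (hd : ∀ l, d l ≠ 0) (hci : A.IsCompleteIntersection)
    (hco : ∀ p : PP k (Fin (n + 1)), ¬ A.IsCoincident p)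
    {π : A.incidence ⟶ A.singXne} (hπ : π ≫ A.singι = A.incidenceFst) (z : A.singXne) :
    ∃ (U : A.singXne.Opens) (_ : z ∈ U) (Q : Scheme.{u}) (q : Q ⟶ U) (v : Q ⟶ A.incidence),
      (IsFinite q ∧ Flat q ∧ ∀ z, q.finrank z = 2 ^ r) ∧ IsPullback v q π U.ι := by
  obtain ⟨a, ha⟩ := A.exists_adjugate_notMem_XneToPP hd (A.singι z)
  obtain ⟨o, e, he⟩ := A.exists_jacobian_minor_notMem hci (hco _) (A.XneToPP_mem (A.singι z))
    (A.detForm_mem_pointIdeal (A.singι z))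
  have hm := A.jacobianMinor_notMem he
  have hzx : A.singX z ∈ ⨆ i : Fin (n + 1), chart k i := by rw [iSup_chart_eq_top]; trivial
  obtain ⟨i, hi⟩ := TopologicalSpace.Opens.mem_iSup.1 hzx
  choose ea hea using fun l => A.isHomogeneous_adjugate l (a l) (a l)
  obtain ⟨em, hem⟩ := A.isHomogeneous_jacobianMinor e o
  -- On `O` the coordinate `x_i`, the principal minors of all blocks and the chosen Jacobian minor
  -- vanish nowhere.
  let O : (PP k (Fin (n + 1))).Opens := (chart k i ⊓
    ⨅ l, Proj.basicOpen (grading k _) ((A.blockMatrix l).adjugate (a l) (a l))) ⊓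
    Proj.basicOpen (grading k _) (A.jacobianMinor e o)
  have hO : A.singX z ∈ O := by
    refine ⟨⟨hi, ?_⟩, hm⟩
    rw [TopologicalSpace.Opens.coe_iInf]
    exact Set.mem_iInter.2 fun l => ha l
  let U : A.singXne.Opens := A.singX ⁻¹ᵁ O
  have hU : ∀ t : U, (U.ι ≫ A.singX) t ∈ O := fun t => t.2
  have hUi : ⊤ ≤ (U.ι ≫ A.singX) ⁻¹ᵁ chart k i := fun t _ => (hU t).1.1
  obtain ⟨Q, q, v, hq, h⟩ := A.exists_isPullback hπ U.ι hUi
    (fun l => isUnit_evalAt _ _ _ hUi (hea l) fun t _ =>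
      iInf_le (fun l => Proj.basicOpen (grading k (Fin (n + 1)))
        ((A.blockMatrix l).adjugate (a l) (a l))) l (hU t).1.2)
    (isUnit_evalAt _ _ _ hUi hem fun t _ => (hU t).2)
  exact ⟨U, hO, Q, q, v, hq, h⟩

/-- The incidence scheme is a finite flat cover of degree `2 ^ r` of the singular subscheme. -/
theorem isFinite_flat_finrank (hd : ∀ l, d l ≠ 0) (hci : A.IsCompleteIntersection)
    (hco : ∀ p : PP k (Fin (n + 1)), ¬ A.IsCoincident p)
    {π : A.incidence ⟶ A.singXne} (hπ : π ≫ A.singι = A.incidenceFst) :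
    IsFinite π ∧ Flat π ∧ ∀ z, π.finrank z = 2 ^ r := by
  choose U hzU Q q v hq hpb using A.exists_opens_isPullback hd hci hco hπ
  have hU : iSup U = ⊤ := top_le_iff.1 fun z _ =>
    TopologicalSpace.Opens.mem_iSup.2 ⟨z, hzU z⟩
  have hfac : ∀ z, π ∣_ U z =
      ((isPullback_morphismRestrict π (U z)).flip.isoIsPullback _ _ (hpb z)).hom ≫ q z := fun z =>
    ((isPullback_morphismRestrict π (U z)).flip.isoIsPullback_hom_snd _ _ (hpb z)).symm
  have hfin : IsFinite π := by
    have : IsZariskiLocalAtTarget @IsFinite.{u} :=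
      @HasAffineProperty.instIsZariskiLocalAtTarget _ _
        IsFinite.instHasAffinePropertyAndIsAffineFiniteCarrierObjOppositeOpensCarrierCarrierCommRingCatPresheafOpOpensTopHomAppTop
    refine IsZariskiLocalAtTarget.of_iSup_eq_top (P := @IsFinite) U hU fun z => ?_
    have := (hq z).1
    rw [hfac z]
    infer_instance
  have hflat : Flat π := by
    have : IsZariskiLocalAtTarget @Flat.{u} := by
      apply HasRingHomProperty.instIsZariskiLocalAtTarget
    refine IsZariskiLocalAtTarget.of_iSup_eq_top (P := @Flat) U hU fun z => ?_
    have := (hq z).2.1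
    rw [hfac z]
    infer_instance
  refine ⟨hfin, hflat, fun z => ?_⟩
  rw [← (hq z).2.2 ⟨z, hzU z⟩]
  exact (Scheme.Hom.finrank_of_isPullback _ _ _ _ (hpb z) ⟨z, hzU z⟩).symm

end BlockTensor

end

end

end Symmetroid

theorem mainTheorem1 {k : Type u} [Field k] (h2 : (2 : k) ≠ 0) (h3 : (3 : k) ≠ 0)
    {n r : ℕ} (hr : 1 ≤ r) (d : Fin r → ℕ) (hd : ∀ l, 2 ≤ d l)
    (A : Symmetroid.BlockTensor k n r d)
    (hirr : ∀ l, Irreducible (A.detForm l))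
    (hci : A.IsCompleteIntersection)
    (hdim : topologicalKrullDim A.singXne = 0)
    (hco : ∀ p : Symmetroid.PP k (Fin (n + 1)), ¬ A.IsCoincident p) :
    ∃ π : A.incidence ⟶ A.singXne,
      π ≫ A.singIdeal.subschemeι = A.incidenceFst ∧
      IsFinite π ∧ Flat π ∧ ∀ z : A.singXne, π.finrank z = 2 ^ (r - 1) := by
  -- With `r + 1` blocks the truncated exponent `r - 1` of the statement becomes the new `r`, the
  -- number of adjoined roots.
  obtain ⟨r, rfl⟩ := Nat.exists_eq_add_of_le' hr
  have hd0 : ∀ l, d l ≠ 0 := fun l => by have := hd l; omega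
  obtain ⟨π, hπ⟩ := Symmetroid.exists_lift_subscheme (A.singIdeal_le_ker_incidenceFst hd0)
  exact ⟨π, hπ, A.isFinite_flat_finrank hd0 hci hco hπ⟩
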